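/- Let $(X,d)$ be a non-empty compact metric space and let $T$ be a correspondence on $X$, i.e. an upper semicontinuous map from $X$ to the set of non-empty closed subsets of $X$ (for every $x$ and every open $U\supseteq T(x)$ one has $T(y)\subseteq U$ for all $y$ in a neighbourhood of $x$). Put $\mathcal O_{n}(T)=\{(x_1,\dots,x_{n})\in X^{n}: x_{i+1}\in T(x_i),\ 1\le i<n\}$, with the metric $d_n(x,y)=\max_i d(x_i,y_i)$, and let $C(\mathcal O_2(T))$ be the space of continuous functions $\mathcal O_2(T)\to\mathbb R$ with the supremum norm. For $\phi\in C(\mathcal O_2(T))$ let $$P(T,\phi)=\lim_{\epsilon\to0^+}\limsup_{n\to\infty}\frac1n\log\sup_{E}\sum_{x\in E}\exp\Big(\sum_{i=1}^{n}\phi(x_i,x_{i+1})\Big),$$ where $E$ ranges over the $\epsilon$-separated subsets of $\mathcal O_{n+1}(T)$ (distinct points at distance at least $\epsilon$). A transition probability kernel $\mathcal Q$ on $X$ (with its Borel $\sigma$-algebra) is supported by $T$ if $\mathcal Q_x(T(x))=1$ for every $x\in X$. For such a $\mathcal Q$ and a Borel probability measure $\mu$ on $X$, write $I_{\mathcal Q,\mu}(\phi)=\int_X\int_{T(x_1)}\phi(x_1,x_2)\,d\mathcal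 Q_{x_1}(x_2)\,d\mu(x_1)$ and let $$\mathfrak h_\mu(\mathcal Q)=\inf\{I_{\mathcal Q,\mu}(\phi):\phi\in C(\mathcal O_2(T)),\ P(T,-\phi)\le 0\}\in[-\infty,+\infty]$$ be the abstract entropy. The probability measure $\mu$ is $\mathcal Q$-invariant if $\mu\mathcal Q=\mu$, where $(\mu\mathcal Q)(A)=\int_X\mathcal Q_x(A)\,d\mu(x)$. In that case let $$h_\mu(\mathcal Q)=\sup_{\mathcal A}\lim_{n\to\infty}\frac1n H_{\mu\mathcal Q^{[n-1]}}(\mathcal A^n)$$ be the measure-theoretic entropy. Here $\mathcal A$ ranges over the finite measurable partitions of $X$; $\mathcal A^n$ is the partition of $X^n$ into products of cells of $\mathcal A$; $\mu\mathcal Q^{[n-1]}$ is the law on $X^n$ of the first $n$ states of the Markov chain with initial law $\mu$ and transition kernel $\mathcal Q$; and $H_\nu(\mathcal B)=-\sum_{B\in\mathcal B}\nu(B)\log\nu(B)$. Let $\phi\in C(\mathcal O_2(T))$. A pair $(\mathcal Q,\mu)$ consisting of a transition probability kernel supported by $T$ and a Borel probability measure is a type II equilibrium state for $\phi$ if $P(T,\phi)=\mathfrak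 h_\mu(\mathcal Q)+I_{\mathcal Q,\mu}(\phi)$. It is a type I equilibrium state for $\phi$ if $\mu$ is $\mathcal Q$-invariant and $P(T,\phi)=h_\mu(\mathcal Q)+I_{\mathcal Q,\mu}(\phi)$. Two pairs $(\mathcal Q,\mu)$ and $(\mathcal Q',\mu')$ are identified if $\mu=\mu'$ and, for $\mu$-almost every $x\in X$, $\mathcal Q_x(A)=\mathcal Q'_x(A)$ for all Borel sets $A\subseteq X$. Assume that the topological entropy $P(T,0)$ is finite. Then there is a dense subset $D$ of $C(\mathcal O_2(T))$ such that every $\phi\in D$ has, up to this identification, exactly one type II equilibrium state and at most one type I equilibrium state. -/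

import Mathlib

open Set Filter Topology MeasureTheory ProbabilityTheory
open scoped ENNReal

/-- A correspondence on `X`: an upper semicontinuous map from `X` to the non-empty closed
subsets of `X`. Upper semicontinuity (Mathlib's `UpperHemicontinuous`) says that for every `x` and
every open `U` containing `T x` one has `T y ⊆ U` for all `y` near `x`; see `upper_iff` below. -/
structure Correspondence (X : Type*) [TopologicalSpace X] where
  /-- The underlying set-valued map. -/
  toFun : X → Set X
  nonempty' : ∀ x, (toFun x).Nonempty
  isClosed' : ∀ x, IsClosed (toFun x)
  upper' : UpperHemicontinuous toFun

/-- A finite measurable partition of `X`, listed as `cell 0, …, cell (card - 1)`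
(empty cells are allowed and contribute nothing to entropies). -/
structure FiniteMeasurablePartition (X : Type*) [MeasurableSpace X] where
  /-- The number of listed cells. -/
  card : ℕ
  /-- The cells. -/
  cell : Fin card → Set X
  measurableSet_cell : ∀ i, MeasurableSet (cell i)
  disjoint_cell : Pairwise fun i j => Disjoint (cell i) (cell j)
  iUnion_cell : ⋃ i, cell i = univ

namespace Correspondence

section Topological

variable {X : Type*} [TopologicalSpace X]

instance : CoeFun (Correspondence X) (fun _ => X → Set X) := ⟨Correspondence.toFun⟩

theorem upper_iff (F : X → Set X) :
    UpperHemicontinuous F ↔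
      ∀ x U, IsOpen U → F x ⊆ U → ∃ V, IsOpen V ∧ x ∈ V ∧ ∀ y ∈ V, F y ⊆ U := by
  rw [upperHemicontinuous_iff_forall_isOpen]
  refine forall₄_congr fun x U _ _ => ?_
  rw [eventually_nhds_iff]
  constructor
  · rintro ⟨V, h1, h2, h3⟩
    exact ⟨V, h2, h3, h1⟩
  · rintro ⟨V, h1, h2, h3⟩
    exact ⟨V, h3, h1, h2⟩

/-- The graph `O₂(T) = {(x₁, x₂) : x₂ ∈ T x₁}`. The space of potentials is `C(T.graph, ℝ)`. -/
def graph (T : Correspondence X) : Set (X × X) := {p | p.2 ∈ T p.1}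

theorem isClosed_graph [RegularSpace X] (T : Correspondence X) : IsClosed T.graph := by
  rw [← isOpen_compl_iff, isOpen_iff_mem_nhds]
  rintro ⟨x, y⟩ hxy
  have hy : (T x)ᶜ ∈ 𝓝 y := (T.isClosed' x).isOpen_compl.mem_nhds hxy
  obtain ⟨K, hK, hKc, hKs⟩ := exists_mem_nhds_isClosed_subset hy
  have hU : ∀ᶠ z in 𝓝 x, T z ⊆ Kᶜ :=
    T.upper'.forall_isOpen x Kᶜ hKc.isOpen_compl (fun z hz hzK => hKs hzK hz)
  filter_upwards [prod_mem_nhds hU hK] with p hp h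
  exact hp.1 h hp.2

/-- The graph is compact, so the topology of `C(T.graph, ℝ)` is that of uniform convergence. -/
instance [CompactSpace X] [RegularSpace X] (T : Correspondence X) : CompactSpace T.graph :=
  isCompact_iff_compactSpace.mp T.isClosed_graph.isCompact

/-- The set `O_{n+1}(T)` of orbits `(x₁, …, x_{n+1})`, with `x_{i+1} ∈ T x_i`. -/
def Orbit (T : Correspondence X) (n : ℕ) : Type _ :=
  {x : Fin (n + 1) → X // ∀ i : Fin n, x i.succ ∈ T (x i.castSucc)}

/-- The Birkhoff sum `S_n φ (x₁, …, x_{n+1}) = ∑_{i=1}^n φ (x_i, x_{i+1})`. -/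
def birkhoff (T : Correspondence X) (φ : C(T.graph, ℝ)) (n : ℕ) (x : T.Orbit n) : ℝ :=
  ∑ i : Fin n, φ ⟨(x.1 i.castSucc, x.1 i.succ), x.2 i⟩

end Topological

noncomputable section

section Pressure

variable {X : Type*} [MetricSpace X]

/-- `E ⊆ O_{n+1}(T)` is `ε`-separated for `d_{n+1}(x, y) = max_i d(x_i, y_i)` (which is the distance
of the finite product `Fin (n + 1) → X` in Mathlib). If `X` is compact, separated sets are finite,
so restricting to finsets loses nothing. -/
def IsSeparated (T : Correspondence X) (n : ℕ) (ε : ℝ) (E : Finset (T.Orbit n)) : Prop :=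
  ∀ x ∈ E, ∀ y ∈ E, x ≠ y → ε ≤ dist x.1 y.1

/-- `s_n(T, φ, ε) = sup {∑_{x ∈ E} exp (S_n φ x) : E ⊆ O_{n+1}(T) is ε-separated}`. -/
def separatedSum (T : Correspondence X) (φ : C(T.graph, ℝ)) (n : ℕ) (ε : ℝ) : ℝ≥0∞ :=
  ⨆ (E : Finset (T.Orbit n)) (_ : T.IsSeparated n ε E),
    ∑ x ∈ E, ENNReal.ofReal (Real.exp (T.birkhoff φ n x))

/-- `limsup_{n → ∞} (1 / n) log s_n(T, φ, ε)`. -/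
def pressureAt (T : Correspondence X) (φ : C(T.graph, ℝ)) (ε : ℝ) : EReal :=
  limsup (fun n : ℕ => ENNReal.log (T.separatedSum φ n ε) / (n : EReal)) atTop

/-- The topological pressure `P(T, φ) = lim_{ε → 0+} limsup_n (1 / n) log s_n(T, φ, ε)`. The limit
is monotone, hence written as a supremum; see `tendsto_pressureAt`. -/
def pressure (T : Correspondence X) (φ : C(T.graph, ℝ)) : EReal :=
  ⨆ (ε : ℝ) (_ : 0 < ε), T.pressureAt φ ε

theorem pressureAt_antitone (T : Correspondence X) (φ : C(T.graph, ℝ)) :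
    Antitone (T.pressureAt φ) := by
  intro ε δ h
  refine limsup_le_limsup (Eventually.of_forall fun n => ?_)
  refine EReal.div_le_div_right_of_nonneg (Nat.cast_nonneg' n) (ENNReal.log_monotone ?_)
  exact iSup_mono fun E => iSup_mono' fun hE =>
    ⟨fun x hx y hy hxy => h.trans (hE x hx y hy hxy), le_rfl⟩

theorem tendsto_pressureAt (T : Correspondence X) (φ : C(T.graph, ℝ)) :
    Tendsto (T.pressureAt φ) (𝓝[>] 0) (𝓝 (T.pressure φ)) := by
  refine tendsto_order.2 ⟨fun a ha => ?_, fun a ha => ?_⟩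
  · simp only [pressure, lt_iSup_iff] at ha
    obtain ⟨ε, hε, h⟩ := ha
    filter_upwards [Ioc_mem_nhdsGT hε] with δ hδ
    exact h.trans_le (T.pressureAt_antitone φ hδ.2)
  · filter_upwards [self_mem_nhdsWithin] with δ hδ
    exact (le_iSup₂ (f := fun (ε : ℝ) (_ : 0 < ε) => T.pressureAt φ ε) δ hδ).trans_lt ha

/-- The topological entropy `h(T) = P(T, 0)`. -/
def topEntropy (T : Correspondence X) : EReal := T.pressure 0

end Pressure

section Kernels

variable {X : Type*} [MeasurableSpace X]

theorem measurable_snoc (n : ℕ) :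
    Measurable fun p : (Fin (n + 1) → X) × X =>
      (Fin.snoc (α := fun _ => X) p.1 p.2 : Fin (n + 2) → X) := by
  refine measurable_pi_lambda _ fun i => ?_
  refine Fin.lastCases ?_ (fun j => ?_) i
  · simpa using measurable_snd
  · simpa [Function.comp_def] using (measurable_pi_apply (X := fun _ : Fin (n + 1) => X) j).comp
      (measurable_fst (β := X))

/-- The kernel `Q^[n]` from `X` to `X^{n+1}`: the law of the first `n + 1` states of the Markov
chain with transition kernel `Q` started at `x`. One has `Q^[0]_x = δ_x`, and `Q^[n+1]` is obtained
by appending a state drawn from `Q` at the last state; see `pathKernel_succ_apply`. -/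
def pathKernel (Q : Kernel X X) : (n : ℕ) → Kernel X (Fin (n + 1) → X)
  | 0 => Kernel.deterministic (fun x _ => x) (measurable_pi_lambda _ fun _ => measurable_id)
  | n + 1 =>
    ((pathKernel Q n) ⊗ₖ (Q.comap (fun p : X × (Fin (n + 1) → X) => p.2 (Fin.last n))
      ((measurable_pi_apply _).comp measurable_snd))).map
        (fun p => Fin.snoc (α := fun _ => X) p.1 p.2)

instance (Q : Kernel X X) [IsMarkovKernel Q] (n : ℕ) : IsMarkovKernel (pathKernel Q n) := by
  induction n with
  | zero => unfold pathKernel; infer_instance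
  | succ n ih => unfold pathKernel; exact Kernel.IsMarkovKernel.map _ (measurable_snoc n)

theorem pathKernel_succ_apply (Q : Kernel X X) [IsMarkovKernel Q] (n : ℕ) (x : X)
    {A : Set (Fin (n + 2) → X)} (hA : MeasurableSet A) :
    pathKernel Q (n + 1) x A =
      ∫⁻ w, Q (w (Fin.last n)) {y | Fin.snoc (α := fun _ => X) w y ∈ A} ∂(pathKernel Q n x) := by
  rw [pathKernel, Kernel.map_apply' _ (measurable_snoc n) _ hA,
    Kernel.compProd_apply (measurable_snoc n hA)]
  rfl

/-- `H_{μ Q^[n]}(𝒜^{n+1})`, where `H_ν(ℬ) = - ∑_{B ∈ ℬ} ν(B) log ν(B)`, where `μ Q^[n]` is the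
push-forward of `μ` by `Q^[n]`, and where `𝒜^{n+1}` consists of the products of cells of `𝒜`. -/
def blockEntropy (Q : Kernel X X) (μ : Measure X) (𝒜 : FiniteMeasurablePartition X) (n : ℕ) : ℝ :=
  ∑ w : Fin (n + 1) → Fin 𝒜.card,
    Real.negMulLog ((μ.bind (pathKernel Q n)).real (univ.pi fun i => 𝒜.cell (w i)))

/-- `h_μ(Q, 𝒜) = lim_{n → ∞} (1 / n) H_{μ Q^[n-1]}(𝒜ⁿ)` (reindexed by `n ↦ n + 1`). The limit
exists by subadditivity when `μ` is `Q`-invariant, and so equals this upper limit. -/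
def entropyWrt (Q : Kernel X X) (μ : Measure X) (𝒜 : FiniteMeasurablePartition X) : EReal :=
  limsup (fun n : ℕ => ((blockEntropy Q μ 𝒜 n / ((n : ℝ) + 1) : ℝ) : EReal)) atTop

/-- The measure-theoretic entropy `h_μ(Q) = sup_𝒜 h_μ(Q, 𝒜)`. -/
def kernelEntropy (Q : Kernel X X) (μ : Measure X) : EReal :=
  ⨆ 𝒜 : FiniteMeasurablePartition X, entropyWrt Q μ 𝒜

end Kernels

section Equilibrium

variable {X : Type*} [MetricSpace X] [MeasurableSpace X]

/-- `Q` is supported by `T` if `Q_x(T x) = 1` for every `x`. -/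
def Supports (T : Correspondence X) (Q : Kernel X X) : Prop := ∀ x, Q x (T x) = 1

/-- `∫_X ∫_{T x₁} φ(x₁, x₂) dQ_{x₁}(x₂) dμ(x₁)`. The potential is extended from the graph to
`X × X` by `0`; the inner integral over `T x₁` never sees the added values. -/
def doubleIntegral (T : Correspondence X) (Q : Kernel X X) (μ : Measure X)
    (φ : C(T.graph, ℝ)) : ℝ :=
  ∫ x₁, (∫ x₂ in T x₁,
    Function.extend (Subtype.val : T.graph → X × X) (⇑φ) 0 (x₁, x₂) ∂(Q x₁)) ∂μ

/-- The abstract measure-theoretic entropy: the infimum of `∫∫ φ dQ dμ` over the potentials `φ`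
with `P(T, -φ) ≤ 0`. It may be `-∞`, so it takes values in the extended reals. -/
def abstractEntropy (T : Correspondence X) (Q : Kernel X X) (μ : Measure X) : EReal :=
  ⨅ (φ : C(T.graph, ℝ)) (_ : T.pressure (-φ) ≤ 0), (T.doubleIntegral Q μ φ : EReal)

/-- `(Q, μ)` is a type I equilibrium state for `T` and `φ`. -/
structure IsEquilibriumI (T : Correspondence X) (φ : C(T.graph, ℝ)) (Q : Kernel X X)
    (μ : Measure X) : Prop where
  markov : IsMarkovKernel Q
  supports : T.Supports Q
  prob : IsProbabilityMeasure μ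
  invariant : Kernel.Invariant Q μ
  pressure_eq : T.pressure φ = kernelEntropy Q μ + (T.doubleIntegral Q μ φ : EReal)

/-- `(Q, μ)` is a type II equilibrium state for `T` and `φ`. Here `μ` is any Borel probability
measure. -/
structure IsEquilibriumII (T : Correspondence X) (φ : C(T.graph, ℝ)) (Q : Kernel X X)
    (μ : Measure X) : Prop where
  markov : IsMarkovKernel Q
  supports : T.Supports Q
  prob : IsProbabilityMeasure μ
  pressure_eq : T.pressure φ = T.abstractEntropy Q μ + (T.doubleIntegral Q μ φ : EReal)

end Equilibrium

end

end Correspondence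

/-! Finite topological entropy makes the pressure a real-valued convex 1-Lipschitz function on
`C(T.graph, ℝ)`, and equilibrium states of `φ`, of either type, integrate to subgradients of it at
`φ`. The graph is compact metric, so this space is a separable Banach space, and Mazur's theorem
(`LipschitzWith.dense_subsingleton_subgradient`) yields a dense set of potentials with at most one
subgradient. This set is `D`.

A pair `(Q, μ)` supported by `T` is encoded by the law `μ ⊗ₘ Q`, which lives on the graph; equality
of laws forces the identification in the statement (`eq_of_pairMeasure_eq`). Uniqueness of either
type is therefore uniqueness of the subgradient.

Abstract entropy is a Legendre dual of the pressure, so type II states are exactly the supported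
pairs whose integral is a subgradient. One exists by Hahn-Banach: monotonicity and translation
equivariance of the pressure turn a subgradient into a probability measure via Riesz, and this
measure disintegrates into a supported pair (`exists_pairMeasure_eq`).

For type I states only the inequality `h_μ(Q) + ∫∫ φ ≤ P(T, φ)` is needed (`kernelEntropy_le_sub`).
It comes from Gibbs' inequality, with the law of the itinerary compared to a mixture of product
measures centred at the points of a separated net. -/

open scoped CompactlySupported

namespace Correspondence

/-! ### The pressure as a finite, convex, Lipschitz function -/

section PressureFunction

variable {X : Type*} [MetricSpace X]

theorem separatedSum_le_ofReal_iff (T : Correspondence X) (φ : C(T.graph, ℝ)) (n : ℕ) (ε : ℝ)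
    {r : ℝ} (hr : 0 ≤ r) :
    T.separatedSum φ n ε ≤ ENNReal.ofReal r ↔
      ∀ E, T.IsSeparated n ε E → ∑ x ∈ E, Real.exp (T.birkhoff φ n x) ≤ r := by
  simp only [separatedSum, iSup_le_iff]
  refine forall₂_congr fun E _ => ?_
  rw [← ENNReal.ofReal_sum_of_nonneg fun _ _ => (Real.exp_pos _).le,
    ENNReal.ofReal_le_ofReal_iff hr]

/-- Together with the converse `pressure_le_of_eventually`, this replaces limits in `EReal` by real
finite-sum estimates; the strict bound by a real `a` avoids arithmetic at infinity. -/
theorem eventually_sum_le_of_pressure_lt (T : Correspondence X) {φ : C(T.graph, ℝ)} {a ε : ℝ}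
    (h : T.pressure φ < a) (hε : 0 < ε) :
    ∀ᶠ n : ℕ in atTop, ∀ E, T.IsSeparated n ε E →
      ∑ x ∈ E, Real.exp (T.birkhoff φ n x) ≤ Real.exp (n * a) := by
  have h1 : T.pressureAt φ ε < a :=
    (le_iSup₂ (f := fun (ε : ℝ) (_ : 0 < ε) => T.pressureAt φ ε) ε hε).trans_lt h
  filter_upwards [eventually_lt_of_limsup_lt h1, eventually_gt_atTop 0] with n hn hn0
  rw [← separatedSum_le_ofReal_iff T φ n ε (Real.exp_pos _).le, ← EReal.exp_coe]
  have hlog : ENNReal.log (T.separatedSum φ n ε) ≤ ((n * a : ℝ) : EReal) := by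
    have := hn.le
    rw [EReal.div_le_iff_le_mul (by exact_mod_cast hn0) (EReal.natCast_ne_top n)] at this
    simpa [mul_comm] using this
  simpa using EReal.exp_monotone hlog

theorem pressure_le_of_eventually (T : Correspondence X) {φ : C(T.graph, ℝ)} {a : ℝ}
    (h : ∀ ε > 0, ∀ᶠ n : ℕ in atTop, ∀ E, T.IsSeparated n ε E →
      ∑ x ∈ E, Real.exp (T.birkhoff φ n x) ≤ Real.exp (n * a)) :
    T.pressure φ ≤ a := by
  refine iSup₂_le fun ε hε => limsup_le_of_le (h := ?_)
  filter_upwards [h ε hε, eventually_gt_atTop 0] with n hn hn0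
  rw [← separatedSum_le_ofReal_iff T φ n ε (Real.exp_pos _).le, ← EReal.exp_coe] at hn
  rw [EReal.div_le_iff_le_mul (by exact_mod_cast hn0) (EReal.natCast_ne_top n)]
  have := ENNReal.log_monotone hn
  simpa [mul_comm] using this

theorem birkhoff_le_add (T : Correspondence X) {φ ψ : C(T.graph, ℝ)} {c : ℝ}
    (h : ∀ p, φ p ≤ ψ p + c) (n : ℕ) (x : T.Orbit n) :
    T.birkhoff φ n x ≤ T.birkhoff ψ n x + n * c := by
  calc T.birkhoff φ n x ≤ ∑ i : Fin n, (ψ ⟨(x.1 i.castSucc, x.1 i.succ), x.2 i⟩ + c) :=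
        Finset.sum_le_sum fun i _ => h _
    _ = T.birkhoff ψ n x + n * c := by simp [Finset.sum_add_distrib, birkhoff]

/-- A single inequality holding both monotonicity (`c = 0`) and behaviour under constants; the
Lipschitz bound and the positivity of subgradients both derive from it. -/
theorem pressure_le_add (T : Correspondence X) {φ ψ : C(T.graph, ℝ)} {c a : ℝ}
    (h : ∀ p, φ p ≤ ψ p + c) (ha : T.pressure ψ < a) : T.pressure φ ≤ ((a + c : ℝ) : EReal) := by
  refine T.pressure_le_of_eventually fun ε hε => ?_
  filter_upwards [T.eventually_sum_le_of_pressure_lt ha hε] with n hn E hE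
  calc ∑ x ∈ E, Real.exp (T.birkhoff φ n x)
      ≤ ∑ x ∈ E, Real.exp (T.birkhoff ψ n x) * Real.exp (n * c) :=
        Finset.sum_le_sum fun x _ => by
          rw [← Real.exp_add]; exact Real.exp_le_exp.2 (T.birkhoff_le_add h n x)
    _ ≤ Real.exp (n * a) * Real.exp (n * c) := by
        rw [← Finset.sum_mul]; exact mul_le_mul_of_nonneg_right (hn E hE) (Real.exp_pos _).le
    _ = Real.exp (n * (a + c)) := by rw [← Real.exp_add]; ring_nf

instance [Nonempty X] (T : Correspondence X) (n : ℕ) : Nonempty (T.Orbit n) := by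
  choose f hf using T.nonempty'
  exact ⟨⟨fun i => f^[i] (Classical.arbitrary X), fun i => by
    simpa [Function.iterate_succ_apply'] using hf _⟩⟩

instance [Nonempty X] (T : Correspondence X) : Nonempty T.graph :=
  ⟨⟨(Classical.arbitrary X, (T.nonempty' _).some), (T.nonempty' _).some_mem⟩⟩

variable [CompactSpace X]

/-- One orbit alone is a separated set, and its Birkhoff sum is at least `-n‖φ‖`. -/
theorem pressure_ne_bot [Nonempty X] (T : Correspondence X) (φ : C(T.graph, ℝ)) :
    T.pressure φ ≠ ⊥ := by
  intro h
  have h1 : T.pressure φ < ((-‖φ‖ - 1 : ℝ) : EReal) := by rw [h]; exact EReal.bot_lt_coe _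
  obtain ⟨n, hn, hn0⟩ := ((T.eventually_sum_le_of_pressure_lt h1 one_pos).and
    (eventually_gt_atTop 0)).exists
  obtain ⟨x⟩ : Nonempty (T.Orbit n) := inferInstance
  have h2 := hn {x} (by intro y hy z hz hyz; simp_all)
  rw [Finset.sum_singleton, Real.exp_le_exp] at h2
  have h3 := T.birkhoff_le_add (φ := 0) (ψ := φ) (c := ‖φ‖)
    (fun p => by have := (abs_le.1 (φ.norm_coe_le_norm p)).1; simp; linarith) n x
  have h4 : T.birkhoff 0 n x = 0 := by simp [birkhoff]
  have : (0 : ℝ) < n := by exact_mod_cast hn0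
  nlinarith

theorem pressure_ne_top (T : Correspondence X) (hT : T.topEntropy < ⊤) (φ : C(T.graph, ℝ)) :
    T.pressure φ ≠ ⊤ := by
  obtain ⟨a, ha, -⟩ := EReal.lt_iff_exists_real_btwn.1 hT
  refine ((T.pressure_le_add (φ := φ) (ψ := 0) (c := ‖φ‖) (fun p => ?_) ha).trans_lt
    (EReal.coe_lt_top _)).ne
  simpa using (le_abs_self _).trans (φ.norm_coe_le_norm p)

/-- The topological pressure as a real number. -/
noncomputable def realPressure (T : Correspondence X) (φ : C(T.graph, ℝ)) : ℝ :=
  (T.pressure φ).toReal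

variable [Nonempty X]

theorem coe_realPressure (T : Correspondence X) (hT : T.topEntropy < ⊤) (φ : C(T.graph, ℝ)) :
    (T.realPressure φ : EReal) = T.pressure φ :=
  EReal.coe_toReal (T.pressure_ne_top hT φ) (T.pressure_ne_bot φ)

theorem realPressure_le_add (T : Correspondence X) (hT : T.topEntropy < ⊤)
    {φ ψ : C(T.graph, ℝ)} {c : ℝ} (h : ∀ p, φ p ≤ ψ p + c) :
    T.realPressure φ ≤ T.realPressure ψ + c := by
  refine le_of_forall_pos_le_add fun η hη => ?_
  have := T.pressure_le_add (a := T.realPressure ψ + η) h (by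
    rw [← T.coe_realPressure hT]; exact_mod_cast lt_add_of_pos_right _ hη)
  rw [← T.coe_realPressure hT] at this
  have : T.realPressure φ ≤ T.realPressure ψ + η + c := by exact_mod_cast this
  linarith

theorem convexOn_realPressure (T : Correspondence X) (hT : T.topEntropy < ⊤) :
    ConvexOn ℝ univ T.realPressure := by
  refine ⟨convex_univ, fun φ _ ψ _ a b ha hb hab => ?_⟩
  refine le_of_forall_pos_le_add fun η hη => ?_
  have key (χ : C(T.graph, ℝ)) : T.pressure χ < ((T.realPressure χ + η : ℝ) : EReal) := by
    rw [← T.coe_realPressure hT]; exact_mod_cast lt_add_of_pos_right _ hη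
  set A := T.realPressure φ + η with hA
  set B := T.realPressure ψ + η with hB
  have hfin : T.pressure (a • φ + b • ψ) ≤ ((a * A + b * B : ℝ) : EReal) := by
    refine T.pressure_le_of_eventually fun ε hε => ?_
    filter_upwards [T.eventually_sum_le_of_pressure_lt (key φ) hε,
      T.eventually_sum_le_of_pressure_lt (key ψ) hε] with n hn hn' E hE
    have h1 := hn E hE
    have h2 := hn' E hE
    -- Dividing out the growth rates `A` and `B` makes both exponential sums at most 1, so pointwise
    -- convexity of `exp` suffices in place of Hölder's inequality.
    have hS (x : T.Orbit n) : T.birkhoff (a • φ + b • ψ) n x =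
        n * (a * A + b * B) + (a * (T.birkhoff φ n x - n * A) + b * (T.birkhoff ψ n x - n * B)) := by
      have : T.birkhoff (a • φ + b • ψ) n x = a * T.birkhoff φ n x + b * T.birkhoff ψ n x := by
        simp [birkhoff, Finset.sum_add_distrib, Finset.mul_sum]
      rw [this]; ring
    have hexp (x : T.Orbit n) : Real.exp (T.birkhoff (a • φ + b • ψ) n x) ≤
        Real.exp (n * (a * A + b * B)) * (a * (Real.exp (T.birkhoff φ n x) * Real.exp (-(n * A))) +
          b * (Real.exp (T.birkhoff ψ n x) * Real.exp (-(n * B)))) := by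
      rw [hS, Real.exp_add (n * (a * A + b * B)), ← Real.exp_add _ (-(n * A)),
        ← Real.exp_add _ (-(n * B)), ← sub_eq_add_neg, ← sub_eq_add_neg]
      exact mul_le_mul_of_nonneg_left
        (convexOn_exp.2 (mem_univ _) (mem_univ _) ha hb hab) (Real.exp_pos _).le
    calc ∑ x ∈ E, Real.exp (T.birkhoff (a • φ + b • ψ) n x) ≤ _ :=
          Finset.sum_le_sum fun x _ => hexp x
      _ = Real.exp (n * (a * A + b * B)) *
          (a * ((∑ x ∈ E, Real.exp (T.birkhoff φ n x)) * Real.exp (-(n * A))) +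
          b * ((∑ x ∈ E, Real.exp (T.birkhoff ψ n x)) * Real.exp (-(n * B)))) := by
          simp only [← Finset.mul_sum, Finset.sum_add_distrib, ← Finset.sum_mul]
      _ ≤ Real.exp (n * (a * A + b * B)) * (a * 1 + b * 1) := by
          gcongr
          · rw [Real.exp_neg, ← div_eq_mul_inv]; exact div_le_one_of_le₀ h1 (Real.exp_pos _).le
          · rw [Real.exp_neg, ← div_eq_mul_inv]; exact div_le_one_of_le₀ h2 (Real.exp_pos _).le
      _ = _ := by rw [mul_one, mul_one, hab, mul_one]
  rw [← T.coe_realPressure hT] at hfin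
  have : T.realPressure (a • φ + b • ψ) ≤ a * A + b * B := by exact_mod_cast hfin
  simp only [smul_eq_mul]
  have : a * A + b * B = a * T.realPressure φ + b * T.realPressure ψ + η := by
    rw [hA, hB]; linear_combination η * hab
  linarith

end PressureFunction

end Correspondence

/-! ### Subgradients and Mazur's theorem -/

section Subgradient

/-- A continuous convex function has a continuous linear subgradient at every point. -/
theorem ConvexOn.exists_subgradient {E : Type*} [NormedAddCommGroup E] [NormedSpace ℝ E]
    {p : E → ℝ} (hp : ConvexOn ℝ univ p) (hc : Continuous p) (x : E) :
    ∃ l : E →L[ℝ] ℝ, ∀ y, p x + (l y - l x) ≤ p y := by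
  have hopen : IsOpen {q : E × ℝ | p q.1 < q.2} :=
    isOpen_lt (hc.comp continuous_fst) continuous_snd
  have hconv : Convex ℝ {q : E × ℝ | p q.1 < q.2} := by
    simpa using hp.convex_strict_epigraph
  obtain ⟨f, hf⟩ := geometric_hahn_banach_open_point hconv hopen
    (x := (x, p x)) (by simp)
  have hsplit (y : E) (t : ℝ) : f (y, t) = f (y, 0) + t * f (0, 1) := by
    rw [← smul_eq_mul, ← map_smul, ← map_add]; simp
  -- The separating hyperplane is not vertical, since the epigraph contains a point strictly above
  -- `(x, p x)`.
  have hs : f (0, 1) < 0 := by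
    have := hf (x, p x + 1) (by simp)
    rw [hsplit, hsplit x (p x)] at this
    linarith
  have hle (y : E) : f (y, 0) + p y * f (0, 1) ≤ f (x, 0) + p x * f (0, 1) := by
    refine le_of_forall_pos_lt_add fun η hη => ?_
    -- The excess height is chosen so that `f` loses exactly `η`.
    have := hf (y, p y + η / (-f (0, 1))) (by simpa using div_pos hη (neg_pos.2 hs))
    rw [hsplit, hsplit x, add_mul, div_mul_eq_mul_div, div_neg, mul_div_assoc, div_self hs.ne] at this
    linarith
  refine ⟨(-(f (0, 1)))⁻¹ • f.comp (ContinuousLinearMap.inl ℝ E ℝ), fun y => ?_⟩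
  have h1 := hle y
  simp only [smul_apply, ContinuousLinearMap.comp_apply,
    ContinuousLinearMap.inl_apply, smul_eq_mul]
  have : (-(f (0, 1)))⁻¹ * (f (y, 0) - f (x, 0)) ≤ p y - p x := by
    rw [inv_mul_le_iff₀ (neg_pos.2 hs)]; linarith
  linarith

/-- A real sequence with increments bounded by `c` in absolute value cannot have `N` successive
second differences above `b` if `N * b` is larger than `2 * c`. -/
theorem exists_second_difference_lt {a : ℕ → ℝ} {b c : ℝ} (hc : ∀ j, |a (j + 1) - a j| ≤ c)
    {N : ℕ} (hN : 2 * c < N * b) : ∃ j < N, a (j + 2) + a j - 2 * a (j + 1) < b := by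
  by_contra! h
  have key (j : ℕ) (hj : j ≤ N) : a 1 - a 0 + j * b ≤ a (j + 1) - a j := by
    induction j with
    | zero => simp
    | succ j ih => push_cast; linarith [h j hj, ih (by omega)]
  have h1 := key N le_rfl
  have h2 := abs_le.1 (hc N)
  have h3 := abs_le.1 (hc 0)
  rw [zero_add] at h3
  linarith

/-- **Mazur's theorem** for Lipschitz functions, in a form which only involves subgradients: on a
separable Banach space, the set of points admitting at most one subgradient is dense. -/
theorem LipschitzWith.dense_subsingleton_subgradient {E : Type*} [NormedAddCommGroup E]
    [NormedSpace ℝ E] [CompleteSpace E] [TopologicalSpace.SeparableSpace E] {p : E → ℝ} {K : NNReal}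
    (hp : LipschitzWith K p) :
    Dense {x | ∀ l l' : E →L[ℝ] ℝ, (∀ y, p x + (l y - l x) ≤ p y) →
      (∀ y, p x + (l' y - l' x) ≤ p y) → l = l'} := by
  let f : ℕ → E := TopologicalSpace.denseSeq E
  -- Approximate differentiability at `x` along `f k`: some symmetric second difference is small
  -- relative to the step `t`.
  let U : ℕ → ℕ → Set E := fun k m =>
    {x | ∃ t : ℝ, 0 < t ∧ p (x + t • f k) + p (x - t • f k) - 2 * p x < t / (m + 1)}
  have hpc := hp.continuous
  have hopen (k m : ℕ) : IsOpen (U k m) := by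
    have : U k m = ⋃ (t : ℝ) (_ : 0 < t),
        {x | p (x + t • f k) + p (x - t • f k) - 2 * p x < t / (m + 1)} := by
      ext x; simp [U]
    rw [this]
    exact isOpen_iUnion fun t => isOpen_iUnion fun _ =>
      isOpen_lt (by fun_prop) continuous_const
  have hdense (k m : ℕ) : Dense (U k m) := by
    rw [Metric.dense_iff]
    intro x r hr
    obtain ⟨N, hN⟩ := exists_nat_gt (2 * (K * ‖f k‖) * (m + 1))
    have hfk := norm_nonneg (f k)
    -- `N` steps of size `t` along `f k` stay inside the ball, while `N` is large enough for the
    -- Lipschitz bound to force a small second difference on the way.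
    obtain ⟨t, ht, htr⟩ : ∃ t : ℝ, 0 < t ∧ t * (N * ‖f k‖) < r := by
      have hpos : 0 < N * ‖f k‖ + 1 := by positivity
      refine ⟨r / (N * ‖f k‖ + 1), by positivity, ?_⟩
      rw [div_mul_eq_mul_div, div_lt_iff₀ hpos]
      exact mul_lt_mul_of_pos_left (lt_add_one _) hr
    have hstep (j : ℕ) : |p (x + ((j + 1 : ℕ) * t) • f k) - p (x + (j * t) • f k)| ≤
        K * ‖f k‖ * t := by
      have h1 := hp.dist_le_mul (x + ((j + 1 : ℕ) * t) • f k) (x + (j * t) • f k)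
      rw [Real.dist_eq, dist_add_left, dist_eq_norm, ← sub_smul, norm_smul, Nat.cast_succ,
        add_mul, one_mul, add_sub_cancel_left, Real.norm_of_nonneg ht.le] at h1
      rw [Nat.cast_succ, add_mul, one_mul]
      linarith
    obtain ⟨j, hj, hlt⟩ := exists_second_difference_lt
      (a := fun j : ℕ => p (x + (j * t) • f k)) hstep (N := N) (b := t / (m + 1)) (by
        rw [mul_div_assoc', lt_div_iff₀ (by positivity)]
        nlinarith)
    refine ⟨x + ((j + 1 : ℕ) * t) • f k, ?_, t, ht, ?_⟩
    · rw [Metric.mem_ball, dist_self_add_left, norm_smul, Real.norm_of_nonneg (by positivity)]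
      refine lt_of_le_of_lt ?_ htr
      have : ((j + 1 : ℕ) : ℝ) ≤ N := by exact_mod_cast hj
      calc ((j + 1 : ℕ) : ℝ) * t * ‖f k‖ ≤ N * t * ‖f k‖ := by gcongr
        _ = t * (N * ‖f k‖) := by ring
    · have h1 : x + ((j + 1 : ℕ) * t) • f k + t • f k = x + ((j + 2 : ℕ) * t) • f k := by
        rw [add_assoc, ← add_smul]; push_cast; ring_nf
      have h2 : x + ((j + 1 : ℕ) * t) • f k - t • f k = x + (j * t) • f k := by
        rw [add_sub_assoc, ← sub_smul]; push_cast; ring_nf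
      rw [h1, h2]
      exact hlt
  have hD : Dense (⋂ km : ℕ × ℕ, U km.1 km.2) :=
    dense_iInter_of_isOpen (fun km => hopen _ _) fun km => hdense _ _
  refine hD.mono fun x hx l l' hl hl' => ?_
  have hle (l l' : E →L[ℝ] ℝ) (hl : ∀ y, p x + (l y - l x) ≤ p y)
      (hl' : ∀ y, p x + (l' y - l' x) ≤ p y) (k : ℕ) : l (f k) ≤ l' (f k) := by
    refine le_of_forall_pos_lt_add fun η hη => ?_
    obtain ⟨m, hm⟩ := exists_nat_one_div_lt hη
    obtain ⟨t, ht, h⟩ := mem_iInter.1 hx (k, m)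
    have h1 := hl (x + t • f k)
    have h2 := hl' (x - t • f k)
    simp only [map_add, map_sub, map_smul, smul_eq_mul] at h1 h2
    -- Adding the inequality for `l` at `x + t • f k` to that for `l'` at `x - t • f k` bounds the
    -- left side by the second difference.
    have h3 : t * (l (f k) - l' (f k)) < t * (1 / (m + 1)) := by
      rw [mul_one_div]; linarith
    have := lt_of_mul_lt_mul_left h3 ht.le
    linarith
  refine ContinuousLinearMap.coeFn_injective ?_
  refine l.continuous.ext_on (TopologicalSpace.denseRange_denseSeq E) l'.continuous ?_
  rintro _ ⟨k, rfl⟩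
  exact le_antisymm (hle l l' hl hl' k) (hle l' l hl' hl k)

end Subgradient

namespace Correspondence

/-! ### Supported kernels and measures on the graph -/

section Measures

variable {X : Type*} [MetricSpace X] [CompactSpace X] [MeasurableSpace X] [BorelSpace X]

/-- A correspondence on a compact metric space has a Borel selector. -/
theorem exists_measurable_selector [Nonempty X] (T : Correspondence X) :
    ∃ s : X → X, Measurable s ∧ ∀ x, s x ∈ T x := by
  -- A continuous surjection from the Cantor set codes points by reals; the selector takes the point
  -- of `T x` with the least code.
  obtain ⟨f, hf, hfs⟩ := exists_nat_bool_continuous_surjective_of_compact X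
  let g : cantorSet → X := f ∘ cantorSetHomeomorphNatToBool
  have hg : Continuous g := hf.comp (Homeomorph.continuous _)
  have hgs : Function.Surjective g := hfs.comp (Homeomorph.surjective _)
  have : CompactSpace cantorSet := isCompact_iff_compactSpace.1 isCompact_cantorSet
  have hex (x : X) : ∃ c, g c ∈ T x ∧ ∀ d, g d ∈ T x → (c : ℝ) ≤ d := by
    obtain ⟨y, hy⟩ := T.nonempty' x
    obtain ⟨c, rfl⟩ := hgs y
    obtain ⟨c, hc, hmin⟩ := (((T.isClosed' x).preimage hg).isCompact).exists_isMinOn ⟨c, hy⟩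
      continuous_subtype_val.continuousOn
    exact ⟨c, hc, fun d hd => hmin hd⟩
  choose c hc hmin using hex
  refine ⟨fun x => g (c x), hg.measurable.comp ?_, hc⟩
  refine (MeasurableEmbedding.subtype_coe
    isCompact_cantorSet.measurableSet).measurable_comp_iff.1 (measurable_of_Iic fun a => ?_)
  -- Minimality of `c x` turns the sublevel set into the projection of a compact set, hence a closed
  -- set.
  have hset : (Subtype.val ∘ c) ⁻¹' Iic a =
      Prod.fst '' (T.graph ∩ Prod.snd ⁻¹' (g '' {t | (t : ℝ) ≤ a})) := by
    ext x
    constructor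
    · exact fun hx => ⟨(x, g (c x)), ⟨hc x, c x, hx, rfl⟩, rfl⟩
    · rintro ⟨⟨x, y⟩, ⟨hxy, t, ht, rfl⟩, rfl⟩
      exact (hmin x t hxy).trans ht
  rw [hset]
  have hK : IsClosed (g '' {t | (t : ℝ) ≤ a}) :=
    ((isClosed_le continuous_subtype_val continuous_const).isCompact.image hg).isClosed
  exact ((T.isClosed_graph.inter (hK.preimage continuous_snd)).isCompact.image
    continuous_fst).measurableSet

theorem measurableSet_graph (T : Correspondence X) : MeasurableSet T.graph :=
  T.isClosed_graph.measurableSet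

/-- The law `μ ⊗ Q` of the first two states, as a measure on the graph. -/
noncomputable def pairMeasure (T : Correspondence X) (Q : Kernel X X) (μ : Measure X) :
    Measure T.graph :=
  (μ ⊗ₘ Q).comap Subtype.val

theorem ae_mem_graph (T : Correspondence X) {Q : Kernel X X} [IsMarkovKernel Q] {μ : Measure X}
    [IsProbabilityMeasure μ] (hQ : T.Supports Q) : ∀ᵐ p ∂(μ ⊗ₘ Q), p ∈ T.graph := by
  rw [Measure.ae_compProd_iff (p := fun p => p ∈ T.graph) T.measurableSet_graph]
  refine Eventually.of_forall fun x => ?_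
  exact (mem_ae_iff_prob_eq_one (T.isClosed' x).measurableSet).2 (hQ x)

theorem map_pairMeasure (T : Correspondence X) {Q : Kernel X X} [IsMarkovKernel Q] {μ : Measure X}
    [IsProbabilityMeasure μ] (hQ : T.Supports Q) :
    (T.pairMeasure Q μ).map Subtype.val = μ ⊗ₘ Q := by
  rw [pairMeasure, (MeasurableEmbedding.subtype_coe T.measurableSet_graph).map_comap,
    Subtype.range_coe, Measure.restrict_eq_self_of_ae_mem (T.ae_mem_graph hQ)]

theorem isProbabilityMeasure_pairMeasure (T : Correspondence X) {Q : Kernel X X} [IsMarkovKernel Q]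
    {μ : Measure X} [IsProbabilityMeasure μ] (hQ : T.Supports Q) :
    IsProbabilityMeasure (T.pairMeasure Q μ) := by
  have : IsProbabilityMeasure ((T.pairMeasure Q μ).map Subtype.val) := by
    rw [T.map_pairMeasure hQ]; infer_instance
  exact Measure.isProbabilityMeasure_of_map Subtype.val

omit [CompactSpace X] [MeasurableSpace X] [BorelSpace X] in
theorem extend_apply_of_mem (T : Correspondence X) (φ : C(T.graph, ℝ)) (p : T.graph) :
    Function.extend (Subtype.val : T.graph → X × X) (⇑φ) 0 p = φ p :=
  Subtype.val_injective.extend_apply _ _ _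

theorem measurable_extend (T : Correspondence X) (φ : C(T.graph, ℝ)) :
    Measurable (Function.extend (Subtype.val : T.graph → X × X) (⇑φ) 0) :=
  (MeasurableEmbedding.subtype_coe T.measurableSet_graph).measurable_extend
    φ.continuous.measurable measurable_const

omit [MeasurableSpace X] [BorelSpace X] in
theorem norm_extend_le (T : Correspondence X) (φ : C(T.graph, ℝ)) (p : X × X) :
    ‖Function.extend (Subtype.val : T.graph → X × X) (⇑φ) 0 p‖ ≤ ‖φ‖ := by
  by_cases hp : p ∈ T.graph
  · rw [T.extend_apply_of_mem φ ⟨p, hp⟩]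
    exact φ.norm_coe_le_norm _
  · rw [Function.extend_apply' _ _ _ (by rintro ⟨q, rfl⟩; exact hp q.2)]
    simp

theorem doubleIntegral_eq_integral_compProd (T : Correspondence X) {Q : Kernel X X}
    [IsMarkovKernel Q] {μ : Measure X} [IsProbabilityMeasure μ] (hQ : T.Supports Q)
    (φ : C(T.graph, ℝ)) :
    T.doubleIntegral Q μ φ =
      ∫ p, Function.extend (Subtype.val : T.graph → X × X) (⇑φ) 0 p ∂(μ ⊗ₘ Q) := by
  rw [Measure.integral_compProd (.of_bound (T.measurable_extend φ).aestronglyMeasurable ‖φ‖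
    (Eventually.of_forall (T.norm_extend_le φ)))]
  refine integral_congr_ae (Eventually.of_forall fun x => ?_)
  have : ∀ᵐ y ∂(Q x), y ∈ T x :=
    (mem_ae_iff_prob_eq_one (T.isClosed' x).measurableSet).2 (hQ x)
  simp only [Measure.restrict_eq_self_of_ae_mem this]

theorem doubleIntegral_eq_integral_pairMeasure (T : Correspondence X) {Q : Kernel X X}
    [IsMarkovKernel Q] {μ : Measure X} [IsProbabilityMeasure μ] (hQ : T.Supports Q)
    (φ : C(T.graph, ℝ)) : T.doubleIntegral Q μ φ = ∫ p, φ p ∂(T.pairMeasure Q μ) := by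
  rw [T.doubleIntegral_eq_integral_compProd hQ, ← T.map_pairMeasure hQ,
    (MeasurableEmbedding.subtype_coe T.measurableSet_graph).integral_map]
  simp only [T.extend_apply_of_mem]

/-- The first marginal recovers `μ`, and the disintegration kernel is unique almost everywhere. -/
theorem eq_of_pairMeasure_eq (T : Correspondence X) {Q Q' : Kernel X X} {μ μ' : Measure X}
    [IsMarkovKernel Q] [IsMarkovKernel Q'] [IsProbabilityMeasure μ] [IsProbabilityMeasure μ']
    (hQ : T.Supports Q) (hQ' : T.Supports Q') (h : T.pairMeasure Q μ = T.pairMeasure Q' μ') :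
    μ = μ' ∧ ∀ᵐ x ∂μ, ∀ A : Set X, MeasurableSet A → Q x A = Q' x A := by
  have h1 : μ ⊗ₘ Q = μ' ⊗ₘ Q' := by rw [← T.map_pairMeasure hQ, h, T.map_pairMeasure hQ']
  have h2 : μ = μ' := by rw [← Measure.fst_compProd μ Q, h1, Measure.fst_compProd]
  subst h2
  refine ⟨rfl, ?_⟩
  filter_upwards [Kernel.ae_eq_of_compProd_eq h1] with x hx A _
  rw [hx]

theorem exists_pairMeasure_eq [Nonempty X] (T : Correspondence X) (ν : Measure T.graph)
    [IsProbabilityMeasure ν] :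
    ∃ (Q : Kernel X X) (μ : Measure X), IsMarkovKernel Q ∧ IsProbabilityMeasure μ ∧
      T.Supports Q ∧ T.pairMeasure Q μ = ν := by
  classical
  let ρ : Measure (X × X) := ν.map Subtype.val
  have hρ : IsProbabilityMeasure ρ :=
    Measure.isProbabilityMeasure_map measurable_subtype_coe.aemeasurable
  have hdis : ρ.fst ⊗ₘ ρ.condKernel = ρ := ρ.disintegrate ρ.condKernel
  obtain ⟨s, hs, hsT⟩ := T.exists_measurable_selector
  let G : Set X := {x | ρ.condKernel x (T x) = 1}
  have hG : MeasurableSet G :=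
    (Kernel.measurable_kernel_prodMk_left T.measurableSet_graph) (measurableSet_singleton 1)
  have hae : ∀ᵐ x ∂ρ.fst, x ∈ G := by
    have h1 : ∀ᵐ p ∂(ρ.fst ⊗ₘ ρ.condKernel), p ∈ T.graph := by
      rw [hdis]
      exact (ae_map_iff measurable_subtype_coe.aemeasurable T.measurableSet_graph).2
        (Eventually.of_forall fun p => p.2)
    filter_upwards [Measure.ae_ae_of_ae_compProd h1] with x hx
    exact (mem_ae_iff_prob_eq_one (T.isClosed' x).measurableSet).1 hx
  -- The conditional kernel is carried by `T x` only almost everywhere, whereas `Supports` concerns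
  -- every `x`; a Dirac mass at a Borel selector repairs the null set.
  let Q : Kernel X X := Kernel.piecewise hG ρ.condKernel (Kernel.deterministic s hs)
  have hQm : IsMarkovKernel Q := inferInstance
  have hQs : T.Supports Q := by
    intro x
    by_cases hx : x ∈ G
    · rw [Kernel.piecewise_apply, if_pos hx]; exact hx
    · simp [Q, Kernel.piecewise_apply, hx, Kernel.deterministic_apply, hsT]
  have hQae : Q =ᵐ[ρ.fst] ρ.condKernel := by
    filter_upwards [hae] with x hx
    simp [Q, Kernel.piecewise_apply, hx]
  refine ⟨Q, ρ.fst, hQm, inferInstance, hQs, ?_⟩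
  rw [pairMeasure, Measure.compProd_congr hQae, hdis,
    (MeasurableEmbedding.subtype_coe T.measurableSet_graph).comap_map]

end Measures

/-! ### Subgradients as probability measures -/

section Representation

variable {K : Type*} [MetricSpace K] [CompactSpace K] [MeasurableSpace K] [BorelSpace K]

/-- Integration against a probability measure, as a continuous linear functional on `C(K, ℝ)`. -/
noncomputable def integralCLM (ν : Measure K) [IsProbabilityMeasure ν] : C(K, ℝ) →L[ℝ] ℝ :=
  LinearMap.mkContinuous
    { toFun := fun f => ∫ x, f x ∂ν
      map_add' := fun f g => integral_add (f.continuous.integrable_of_hasCompactSupport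
        (.of_compactSpace _)) (g.continuous.integrable_of_hasCompactSupport (.of_compactSpace _))
      map_smul' := fun c f => integral_smul c f } 1 fun f => by
    simpa using norm_integral_le_of_norm_le_const (μ := ν)
      (Eventually.of_forall f.norm_coe_le_norm)

@[simp]
theorem integralCLM_apply (ν : Measure K) [IsProbabilityMeasure ν] (f : C(K, ℝ)) :
    integralCLM ν f = ∫ x, f x ∂ν := rfl

theorem eq_of_integralCLM_eq {ν ν' : Measure K} [IsProbabilityMeasure ν] [IsProbabilityMeasure ν']
    (h : integralCLM ν = integralCLM ν') : ν = ν' :=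
  ext_of_forall_integral_eq_of_IsFiniteMeasure fun f => congr($h f.toContinuousMap)

/-- A subgradient of a monotone, translation-equivariant function on `C(K, ℝ)` is given by a
probability measure. -/
theorem exists_integralCLM_eq {p : C(K, ℝ) → ℝ}
    (hp : ∀ (f g : C(K, ℝ)) (c : ℝ), (∀ x, f x ≤ g x + c) → p f ≤ p g + c) {φ : C(K, ℝ)}
    {l : C(K, ℝ) →L[ℝ] ℝ} (hl : ∀ ψ, p φ + (l ψ - l φ) ≤ p ψ) :
    ∃ (ν : Measure K) (_ : IsProbabilityMeasure ν), integralCLM ν = l := by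
  -- Testing the subgradient at `φ + f` bounds `l f` by any upper bound of `f`; applied to `-f` and
  -- to `±1` this gives positivity and total mass 1.
  have hle (f : C(K, ℝ)) (c : ℝ) (hf : ∀ x, f x ≤ c) : l f ≤ c := by
    have h1 := hl (φ + f)
    have h2 := hp (φ + f) φ c fun x => by simpa using hf x
    rw [map_add] at h1
    linarith
  have hpos (f : C(K, ℝ)) (hf : ∀ x, 0 ≤ f x) : 0 ≤ l f := by
    have := hle (-f) 0 fun x => by simpa using hf x
    rw [map_neg] at this
    linarith
  have hone : l 1 = 1 := by
    have h1 := hle 1 1 fun x => by simp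
    have h2 := hle (-1) (-1) fun x => by simp
    rw [map_neg] at h2
    linarith
  let Λ : C_c(K, ℝ) →ₚ[ℝ] ℝ := PositiveLinearMap.mk₀
    { toFun := fun f => l f.toContinuousMap
      map_add' := fun f g => l.map_add f.toContinuousMap g.toContinuousMap
      map_smul' := fun c f => l.map_smul c f.toContinuousMap } fun f hf => hpos _ hf
  let ν := RealRMK.rieszMeasure Λ
  have hν (f : C(K, ℝ)) : ∫ x, f x ∂ν = l f :=
    RealRMK.integral_rieszMeasure Λ (CompactlySupportedContinuousMap.continuousMapEquiv f)
  have hprob : IsProbabilityMeasure ν := by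
    have := hν 1
    simp only [ContinuousMap.one_apply, integral_const, smul_eq_mul, mul_one, hone] at this
    exact ⟨by rw [← ENNReal.toReal_eq_one_iff]; exact this⟩
  exact ⟨ν, hprob, ContinuousLinearMap.ext hν⟩

end Representation

/-! ### Type II equilibrium states as subgradients -/

section TypeII

variable {X : Type*} [MetricSpace X] [CompactSpace X] [MeasurableSpace X] [BorelSpace X]
  [Nonempty X]

omit [Nonempty X] in
theorem doubleIntegral_const_sub (T : Correspondence X) {Q : Kernel X X} [IsMarkovKernel Q]
    {μ : Measure X} [IsProbabilityMeasure μ] (hQ : T.Supports Q) (c : ℝ) (φ : C(T.graph, ℝ)) :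
    T.doubleIntegral Q μ (ContinuousMap.const _ c - φ) = c - T.doubleIntegral Q μ φ := by
  have := T.isProbabilityMeasure_pairMeasure (μ := μ) hQ
  have h := map_sub (integralCLM (T.pairMeasure Q μ)) (ContinuousMap.const _ c) φ
  simpa [T.doubleIntegral_eq_integral_pairMeasure hQ] using h

/-- The potential `P(T, φ) - φ` is admissible in the infimum, because the pressure of its negative
is at most 0. -/
theorem abstractEntropy_le (T : Correspondence X) (hT : T.topEntropy < ⊤) {Q : Kernel X X}
    [IsMarkovKernel Q] {μ : Measure X} [IsProbabilityMeasure μ] (hQ : T.Supports Q)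
    (φ : C(T.graph, ℝ)) :
    T.abstractEntropy Q μ ≤ ((T.realPressure φ - T.doubleIntegral Q μ φ : ℝ) : EReal) := by
  rw [← T.doubleIntegral_const_sub hQ]
  refine iInf₂_le _ ?_
  rw [← T.coe_realPressure hT]
  have := T.realPressure_le_add hT (φ := -(ContinuousMap.const _ (T.realPressure φ) - φ)) (ψ := φ)
    (c := -T.realPressure φ) fun p => by simp [sub_eq_add_neg]
  rw [add_neg_cancel] at this
  exact_mod_cast this

theorem IsEquilibriumII.subgradient {T : Correspondence X} (hT : T.topEntropy < ⊤)
    {φ : C(T.graph, ℝ)} {Q : Kernel X X} {μ : Measure X} (h : T.IsEquilibriumII φ Q μ)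
    (ψ : C(T.graph, ℝ)) :
    T.realPressure φ + (T.doubleIntegral Q μ ψ - T.doubleIntegral Q μ φ) ≤
      T.realPressure ψ := by
  have := h.markov
  have := h.prob
  have h1 : (T.realPressure φ : EReal) ≤
      ((T.realPressure ψ - T.doubleIntegral Q μ ψ : ℝ) : EReal) + T.doubleIntegral Q μ φ := by
    rw [T.coe_realPressure hT, h.pressure_eq]
    exact add_le_add_left (T.abstractEntropy_le hT h.supports ψ) _
  have h2 : T.realPressure φ ≤
      T.realPressure ψ - T.doubleIntegral Q μ ψ + T.doubleIntegral Q μ φ := by exact_mod_cast h1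
  linarith

/-- `(Q, μ)` is a type II equilibrium state as soon as `μ ⊗ Q` is a subgradient of the pressure. -/
theorem isEquilibriumII_of_subgradient (T : Correspondence X) (hT : T.topEntropy < ⊤)
    {φ : C(T.graph, ℝ)} {Q : Kernel X X} {μ : Measure X} [IsMarkovKernel Q]
    [IsProbabilityMeasure μ] (hQ : T.Supports Q)
    (h : ∀ ψ, T.realPressure φ + (T.doubleIntegral Q μ ψ - T.doubleIntegral Q μ φ) ≤
      T.realPressure ψ) : T.IsEquilibriumII φ Q μ := by
  refine ⟨inferInstance, hQ, inferInstance, ?_⟩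
  -- For an admissible `ψ`, the subgradient inequality is used at `-ψ`, where the pressure is at
  -- most 0.
  have hge : ((T.realPressure φ - T.doubleIntegral Q μ φ : ℝ) : EReal) ≤
      T.abstractEntropy Q μ := by
    refine le_iInf₂ fun ψ hψ => ?_
    rw [← T.coe_realPressure hT] at hψ
    have h1 : T.realPressure (-ψ) ≤ 0 := by exact_mod_cast hψ
    have h2 := T.doubleIntegral_const_sub (μ := μ) hQ 0 ψ
    have h3 : ContinuousMap.const _ 0 - ψ = -ψ := by ext; simp
    rw [h3, zero_sub] at h2
    have h4 := h (-ψ)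
    rw [h2] at h4
    have : T.realPressure φ - T.doubleIntegral Q μ φ ≤ T.doubleIntegral Q μ ψ := by linarith
    exact_mod_cast this
  rw [le_antisymm (T.abstractEntropy_le hT hQ φ) hge, ← T.coe_realPressure hT, ← EReal.coe_add]
  simp

omit [Nonempty X] in
/-- Pairs whose laws are subgradients of the pressure at a point with at most one subgradient
coincide. -/
theorem eq_of_subgradient (T : Correspondence X) {φ : C(T.graph, ℝ)}
    (hφ : ∀ l l' : C(T.graph, ℝ) →L[ℝ] ℝ,
      (∀ ψ, T.realPressure φ + (l ψ - l φ) ≤ T.realPressure ψ) →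
      (∀ ψ, T.realPressure φ + (l' ψ - l' φ) ≤ T.realPressure ψ) → l = l')
    {Q Q' : Kernel X X} {μ μ' : Measure X} (_ : IsMarkovKernel Q) (_ : IsMarkovKernel Q')
    (_ : IsProbabilityMeasure μ) (_ : IsProbabilityMeasure μ')
    (hQ : T.Supports Q) (hQ' : T.Supports Q')
    (h : ∀ ψ, T.realPressure φ + (T.doubleIntegral Q μ ψ - T.doubleIntegral Q μ φ) ≤
      T.realPressure ψ)
    (h' : ∀ ψ, T.realPressure φ + (T.doubleIntegral Q' μ' ψ - T.doubleIntegral Q' μ' φ) ≤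
      T.realPressure ψ) :
    μ = μ' ∧ ∀ᵐ x ∂μ, ∀ A : Set X, MeasurableSet A → Q x A = Q' x A := by
  have := T.isProbabilityMeasure_pairMeasure (μ := μ) hQ
  have := T.isProbabilityMeasure_pairMeasure (μ := μ') hQ'
  simp only [T.doubleIntegral_eq_integral_pairMeasure hQ,
    T.doubleIntegral_eq_integral_pairMeasure hQ'] at h h'
  exact T.eq_of_pairMeasure_eq hQ hQ' (eq_of_integralCLM_eq (hφ _ _ h h'))

omit [MeasurableSpace X] [BorelSpace X] in
theorem lipschitzWith_realPressure (T : Correspondence X) (hT : T.topEntropy < ⊤) :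
    LipschitzWith 1 T.realPressure := by
  refine LipschitzWith.of_le_add fun φ ψ => T.realPressure_le_add hT fun p => ?_
  have := (abs_le.1 (ContinuousMap.dist_apply_le_dist (f := φ) (g := ψ) p)).2
  linarith

theorem exists_isEquilibriumII (T : Correspondence X) (hT : T.topEntropy < ⊤)
    (φ : C(T.graph, ℝ)) : ∃ (Q : Kernel X X) (μ : Measure X), T.IsEquilibriumII φ Q μ := by
  obtain ⟨l, hl⟩ := (T.convexOn_realPressure hT).exists_subgradient
    (T.lipschitzWith_realPressure hT).continuous φ
  obtain ⟨ν, _, rfl⟩ := exists_integralCLM_eq (fun f g c => T.realPressure_le_add hT) hl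
  obtain ⟨Q, μ, _, _, hQ, rfl⟩ := T.exists_pairMeasure_eq ν
  refine ⟨Q, μ, T.isEquilibriumII_of_subgradient hT hQ fun ψ => ?_⟩
  simpa only [T.doubleIntegral_eq_integral_pairMeasure hQ, integralCLM_apply] using hl ψ

end TypeII

end Correspondence

/-! ### Gibbs' inequality and weights on words -/

section Counting

/-- **Gibbs' inequality**. -/
theorem sum_negMulLog_le_sum_mul_neg_log {ι : Type*} [Fintype ι] {p q : ι → ℝ} (hp : ∀ i, 0 ≤ p i)
    (hp1 : ∑ i, p i = 1) (hq : ∀ i, 0 < q i) (hq1 : ∑ i, q i ≤ 1) :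
    ∑ i, Real.negMulLog (p i) ≤ ∑ i, p i * -Real.log (q i) := by
  have key (i : ι) : Real.negMulLog (p i) ≤ p i * -Real.log (q i) + (q i - p i) := by
    rcases (hp i).eq_or_lt with h | h
    · simp [← h, (hq i).le]
    · have h1 := Real.log_le_sub_one_of_pos (div_pos (hq i) h)
      rw [Real.log_div (hq i).ne' h.ne'] at h1
      have h2 := mul_le_mul_of_nonneg_left h1 h.le
      rw [mul_sub, mul_sub, mul_div_cancel₀ _ h.ne'] at h2
      rw [Real.negMulLog]
      linarith
  have h := Finset.sum_le_sum fun i (_ : i ∈ Finset.univ) => key i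
  rw [Finset.sum_add_distrib, Finset.sum_sub_distrib] at h
  linarith

/-- A subprobability on words which gives each word `w` a mass comparable to the Gibbs weight of
`z`, with an exponential penalty in the number of letters where `w` differs from `v z`. -/
theorem exists_weight_on_words {ι : Type*} (E : Finset ι) (hE : E.Nonempty) (S : ι → ℝ) (m k : ℕ)
    (v : ι → Fin m → Fin k) {ε : ℝ} (hε : 0 < ε) :
    ∃ q : (Fin m → Fin k) → ℝ, (∀ w, 0 < q w) ∧ ∑ w, q w ≤ 1 ∧ ∀ z ∈ E, ∀ w,
      -Real.log (q w) ≤ Real.log (∑ z ∈ E, Real.exp (S z)) - S z + m * ε +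
        |Real.log ((1 - Real.exp (-ε)) / k)| * ∑ i, if w i = v z i then (0 : ℝ) else 1 := by
  set e : ℝ := 1 - Real.exp (-ε) with he
  have he0 : 0 < e := by rw [he, sub_pos, Real.exp_lt_one_iff]; linarith
  -- A noisy copy of the letter `b`: it is kept with weight `exp (-ε)`, and every other letter
  -- receives an equal share `e / k` of the rest. Keeping costs `ε`, an error costs `|log (e / k)|`.
  let r : Fin k → Fin k → ℝ := fun a b => if a = b then Real.exp (-ε) else e / k
  have hr (a b : Fin k) : 0 < r a b := by
    have : (0 : ℝ) < k := by exact_mod_cast a.pos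
    simp only [r]; split_ifs <;> positivity
  have hrlog (a b : Fin k) :
      -Real.log (r a b) ≤ ε + |Real.log (e / k)| * if a = b then (0 : ℝ) else 1 := by
    simp only [r]; split_ifs
    · simp
    · have := neg_abs_le (Real.log (e / k))
      linarith
  have hrsum (b : Fin k) : ∑ a, r a b ≤ 1 := by
    have hk : (0 : ℝ) < k := by exact_mod_cast b.pos
    calc ∑ a, r a b ≤ ∑ a, ((if a = b then Real.exp (-ε) else 0) + e / k) := by
          refine Finset.sum_le_sum fun a _ => ?_
          simp only [r]; split_ifs
          · have : 0 < e / k := by positivity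
            linarith
          · simp
      _ = 1 := by
          rw [Finset.sum_add_distrib, Finset.sum_ite_eq' Finset.univ b]
          simp only [Finset.mem_univ, if_true, Finset.sum_const, Finset.card_univ, Fintype.card_fin,
            nsmul_eq_mul]
          field_simp
          rw [he]; ring
  set Z := ∑ z ∈ E, Real.exp (S z) with hZ
  have hZ0 : 0 < Z := Finset.sum_pos (fun _ _ => Real.exp_pos _) hE
  have hterm (z : ι) (w : Fin m → Fin k) : 0 < Real.exp (S z) / Z * ∏ i, r (w i) (v z i) :=
    mul_pos (div_pos (Real.exp_pos _) hZ0) (Finset.prod_pos fun i _ => hr _ _)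
  -- The Gibbs mixture over `z` of the product weights centred at `v z`; retaining one summand gives
  -- the bound on `-log (q w)`.
  refine ⟨fun w => ∑ z ∈ E, Real.exp (S z) / Z * ∏ i, r (w i) (v z i),
    fun w => Finset.sum_pos (fun z _ => hterm z w) hE, ?_, fun z hz w => ?_⟩
  · rw [Finset.sum_comm]
    calc ∑ z ∈ E, ∑ w : Fin m → Fin k, Real.exp (S z) / Z * ∏ i, r (w i) (v z i)
        ≤ ∑ z ∈ E, Real.exp (S z) / Z := by
          refine Finset.sum_le_sum fun z _ => ?_
          rw [← Finset.mul_sum, ← Fintype.prod_sum fun i a => r a (v z i)]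
          refine mul_le_of_le_one_right (div_pos (Real.exp_pos _) hZ0).le ?_
          exact Finset.prod_le_one (fun i _ => Finset.sum_nonneg fun a _ => (hr _ _).le)
            fun i _ => hrsum _
      _ = 1 := by rw [← Finset.sum_div, ← hZ, div_self hZ0.ne']
  · have h1 := Finset.single_le_sum (f := fun z => Real.exp (S z) / Z * ∏ i, r (w i) (v z i))
      (fun z _ => (hterm z w).le) hz
    have h2 := Real.log_le_log (hterm z w) h1
    rw [Real.log_mul (div_pos (Real.exp_pos _) hZ0).ne' (Finset.prod_pos fun i _ => hr _ _).ne',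
      Real.log_div (Real.exp_pos _).ne' hZ0.ne', Real.log_exp,
      Real.log_prod fun i _ => (hr _ _).ne'] at h2
    have h3 : ∑ i, -Real.log (r (w i) (v z i)) ≤
        m * ε + |Real.log (e / k)| * ∑ i, if w i = v z i then (0 : ℝ) else 1 := by
      refine (Finset.sum_le_sum fun i _ => hrlog (w i) (v z i)).trans_eq ?_
      rw [Finset.sum_add_distrib, ← Finset.mul_sum]
      simp
    rw [Finset.sum_neg_distrib] at h3
    linarith

end Counting

/-! ### Guessing partition labels from nearby points -/

namespace FiniteMeasurablePartition

section

variable {X : Type*} [MeasurableSpace X]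

theorem existsUnique_mem_cell (𝒜 : FiniteMeasurablePartition X) (x : X) :
    ∃ i, ∀ j, x ∈ 𝒜.cell j ↔ i = j := by
  obtain ⟨i, hi⟩ := mem_iUnion.1 (𝒜.iUnion_cell ▸ mem_univ x)
  refine ⟨i, fun j => ⟨fun hj => ?_, fun h => h ▸ hi⟩⟩
  by_contra hij
  exact disjoint_left.1 (𝒜.disjoint_cell hij) hi hj

/-- The index of the cell containing a point. -/
noncomputable def label (𝒜 : FiniteMeasurablePartition X) (x : X) : Fin 𝒜.card :=
  (𝒜.existsUnique_mem_cell x).choose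

theorem mem_cell_iff (𝒜 : FiniteMeasurablePartition X) (x : X) (j : Fin 𝒜.card) :
    x ∈ 𝒜.cell j ↔ 𝒜.label x = j :=
  (𝒜.existsUnique_mem_cell x).choose_spec j

theorem measurable_label (𝒜 : FiniteMeasurablePartition X) : Measurable 𝒜.label := by
  refine measurable_to_countable' fun j => ?_
  convert 𝒜.measurableSet_cell j
  ext x
  simp [mem_cell_iff]

end

/-- Outside of a set of small measure, the label of a point can be guessed from any sufficiently
close point. -/
theorem exists_guess {X : Type*} [MetricSpace X] [CompactSpace X] [Nonempty X] [MeasurableSpace X]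
    [BorelSpace X] (𝒜 : FiniteMeasurablePartition X) (μ : Measure X) [IsProbabilityMeasure μ]
    {κ : ℝ} (hκ : 0 < κ) :
    ∃ G : Set X, MeasurableSet G ∧ μ.real Gᶜ ≤ κ ∧ ∃ δ > 0, ∃ g : X → Fin 𝒜.card,
      ∀ x ∈ G, ∀ z, dist x z < δ → 𝒜.label x = g z := by
  classical
  let x₀ : X := Classical.arbitrary X
  have hk : (0 : ℝ) < 𝒜.card := by exact_mod_cast (𝒜.label x₀).pos
  -- Inner regularity replaces cells by compact subsets, which are pairwise at positive distance.
  -- With gap `2 * δ`, a point `z` is `δ`-close to at most one of them, so `g z` is forced.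
  have hB (i : Fin 𝒜.card) : ∃ K ⊆ 𝒜.cell i, IsCompact K ∧
      μ (𝒜.cell i \ K) < ENNReal.ofReal (κ / 𝒜.card) :=
    (𝒜.measurableSet_cell i).exists_isCompact_sdiff_lt (measure_ne_top _ _)
      (ENNReal.ofReal_pos.2 (div_pos hκ hk)).ne'
  choose B hBsub hBc hBμ using hB
  have hsep (i j : Fin 𝒜.card) : ∀ᶠ δ : ℝ in 𝓝[>] 0, i ≠ j → ∀ x ∈ B i, ∀ y ∈ B j,
      2 * δ ≤ dist x y := by
    by_cases hij : i = j
    · simp [hij]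
    obtain ⟨η, hη, hdisj⟩ := ((𝒜.disjoint_cell hij).mono (hBsub i) (hBsub j)).exists_thickenings
      (hBc i) (hBc j).isClosed
    filter_upwards [Ioc_mem_nhdsGT (half_pos hη)] with δ hδ _ x hx y hy
    by_contra! hlt
    have hxy : dist x y < η := by linarith [hδ.2]
    exact disjoint_left.1 hdisj (Metric.mem_thickening_iff.2 ⟨x, hx, by rwa [dist_comm]⟩)
      (Metric.self_subset_thickening hη _ hy)
  obtain ⟨δ, hδ, hδ0⟩ := ((eventually_all.2 fun i => eventually_all.2 (hsep i)).and
    self_mem_nhdsWithin).exists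
  let g : X → Fin 𝒜.card := fun z =>
    if h : ∃ j, ∃ y ∈ B j, dist y z < δ then h.choose else 𝒜.label x₀
  have hm : MeasurableSet (⋃ i, B i) := .iUnion fun i => (hBc i).measurableSet
  refine ⟨⋃ i, B i, hm, ?_, δ, hδ0, g, fun x hx z hxz => ?_⟩
  · have hsub : (⋃ i, B i)ᶜ ⊆ ⋃ i, 𝒜.cell i \ B i := by
      intro x hx
      refine mem_iUnion.2 ⟨𝒜.label x, (𝒜.mem_cell_iff x _).2 rfl, fun h => hx ?_⟩
      exact mem_iUnion.2 ⟨_, h⟩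
    calc μ.real (⋃ i, B i)ᶜ ≤ μ.real (⋃ i, 𝒜.cell i \ B i) := measureReal_mono hsub
      _ ≤ ∑ i, μ.real (𝒜.cell i \ B i) := measureReal_iUnion_fintype_le _
      _ ≤ ∑ _i : Fin 𝒜.card, κ / 𝒜.card := by
          refine Finset.sum_le_sum fun i _ => ?_
          exact ENNReal.toReal_le_of_le_ofReal (div_pos hκ hk).le (hBμ i).le
      _ = κ := by simp; field_simp
  · obtain ⟨i, hi⟩ := mem_iUnion.1 hx
    have hex : ∃ j, ∃ y ∈ B j, dist y z < δ := ⟨i, x, hi, hxz⟩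
    obtain ⟨y, hy, hyz⟩ := hex.choose_spec
    have hgz : g z = hex.choose := dif_pos hex
    rw [(𝒜.mem_cell_iff x i).1 (hBsub i hi), hgz]
    by_contra hne
    have h1 := hδ i hex.choose hne x hi y hy
    have h2 := dist_triangle_right x y z
    linarith

end FiniteMeasurablePartition

namespace Correspondence

/-! ### Marginals of the stationary Markov chain -/

section PathLaw

variable {X : Type*} [MeasurableSpace X]

/-- The law of the first `n + 1` states of the Markov chain with initial law `μ`. -/
noncomputable def pathLaw (Q : Kernel X X) (μ : Measure X) (n : ℕ) : Measure (Fin (n + 1) → X) :=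
  μ.bind (pathKernel Q n)

variable (Q : Kernel X X) [IsMarkovKernel Q] (μ : Measure X) [IsProbabilityMeasure μ]

instance (n : ℕ) : IsProbabilityMeasure (pathLaw Q μ n) := by
  unfold pathLaw; infer_instance

/-- The kernel giving the next state after a finite path. -/
noncomputable def nextKernel (n : ℕ) : Kernel (Fin (n + 1) → X) X :=
  Q.comap (fun w => w (Fin.last n)) (measurable_pi_apply _)

instance (n : ℕ) : IsMarkovKernel (nextKernel Q n) := by
  unfold nextKernel; infer_instance

theorem pathLaw_succ (n : ℕ) :
    pathLaw Q μ (n + 1) = (pathLaw Q μ n ⊗ₘ nextKernel Q n).map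
      fun p => Fin.snoc (α := fun _ => X) p.1 p.2 := by
  ext A hA
  have hm := measurable_snoc (X := X) n hA
  rw [Measure.map_apply (measurable_snoc n) hA, Measure.compProd_apply hm, pathLaw,
    Measure.bind_apply hA (Kernel.aemeasurable _), pathLaw,
    Measure.lintegral_bind (Kernel.aemeasurable _)
      (Kernel.measurable_kernel_prodMk_left hm).aemeasurable]
  refine lintegral_congr fun x => ?_
  rw [pathKernel_succ_apply Q n x hA]
  rfl

theorem map_last_compProd_nextKernel (n : ℕ) :
    (pathLaw Q μ n ⊗ₘ nextKernel Q n).map (fun p => (p.1 (Fin.last n), p.2)) =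
      ((pathLaw Q μ n).map fun w => w (Fin.last n)) ⊗ₘ Q := by
  have hl : Measurable fun w : Fin (n + 1) → X => w (Fin.last n) := measurable_pi_apply _
  have hf : Measurable fun p : (Fin (n + 1) → X) × X => (p.1 (Fin.last n), p.2) :=
    (hl.comp measurable_fst).prodMk measurable_snd
  have : IsProbabilityMeasure ((pathLaw Q μ n).map fun w => w (Fin.last n)) :=
    Measure.isProbabilityMeasure_map hl.aemeasurable
  ext A hA
  rw [Measure.map_apply hf hA, Measure.compProd_apply (hf hA), Measure.compProd_apply hA,
    lintegral_map (Kernel.measurable_kernel_prodMk_left hA) hl]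
  rfl

variable {Q μ}

theorem map_apply_pathLaw (hμ : Kernel.Invariant Q μ) (n : ℕ) (i : Fin (n + 1)) :
    (pathLaw Q μ n).map (fun w => w i) = μ := by
  induction n with
  | zero =>
    obtain rfl : i = 0 := Fin.fin_one_eq_zero i
    ext A hA
    rw [Measure.map_apply (measurable_pi_apply _) hA, pathLaw,
      Measure.bind_apply (measurable_pi_apply _ hA) (Kernel.aemeasurable _)]
    simp only [pathKernel]
    rw [← lintegral_indicator_one hA]
    refine lintegral_congr fun x => ?_
    rw [Kernel.deterministic_apply' _ _ (measurable_pi_apply _ hA)]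
    rfl
  | succ n ih =>
    rw [pathLaw_succ, Measure.map_map (measurable_pi_apply _) (measurable_snoc n)]
    induction i using Fin.lastCases with
    | last =>
      have h := map_last_compProd_nextKernel Q μ n
      rw [ih] at h
      have h2 : Measurable fun p : (Fin (n + 1) → X) × X => (p.1 (Fin.last n), p.2) :=
        ((measurable_pi_apply _).comp measurable_fst).prodMk measurable_snd
      calc _ = ((pathLaw Q μ n ⊗ₘ nextKernel Q n).map
              (fun p => (p.1 (Fin.last n), p.2))).map Prod.snd := by
            rw [Measure.map_map measurable_snd h2]
            congr 1; ext p; simp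
        _ = μ := by
            rw [h, ← Measure.snd, Measure.snd_compProd]
            exact hμ
    | cast j =>
      calc _ = ((pathLaw Q μ n ⊗ₘ nextKernel Q n).map Prod.fst).map (fun w => w j) := by
            rw [Measure.map_map (measurable_pi_apply _) measurable_fst]
            congr 1; ext p; simp
        _ = μ := by rw [← Measure.fst, Measure.fst_compProd, ih]

/-- Stationarity: every state has law `μ` and its successor is drawn from `Q`. Hence the mean of a
Birkhoff sum of length `n` is `n` times the double integral. -/
theorem map_pair_pathLaw (hμ : Kernel.Invariant Q μ) (n : ℕ) (i : Fin n) :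
    (pathLaw Q μ n).map (fun w => (w i.castSucc, w i.succ)) = μ ⊗ₘ Q := by
  induction n with
  | zero => exact i.elim0
  | succ n ih =>
    rw [pathLaw_succ, Measure.map_map
      ((measurable_pi_apply _).prodMk (measurable_pi_apply _)) (measurable_snoc n)]
    induction i using Fin.lastCases with
    | last =>
      have h := map_last_compProd_nextKernel Q μ n
      rw [map_apply_pathLaw hμ] at h
      rw [← h]
      congr 1; ext p <;> simp
    | cast j =>
      calc _ = ((pathLaw Q μ n ⊗ₘ nextKernel Q n).map Prod.fst).map
              (fun w => (w j.castSucc, w j.succ)) := by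
            rw [Measure.map_map ((measurable_pi_apply _).prodMk (measurable_pi_apply _))
              measurable_fst]
            congr 1; ext p
            · simp
            · simp [-Fin.castSucc_succ, Fin.succ_castSucc]
        _ = μ ⊗ₘ Q := by rw [← Measure.fst, Measure.fst_compProd, ih]

theorem integral_sum_indicator (hμ : Kernel.Invariant Q μ) (n : ℕ) {B : Set X}
    (hB : MeasurableSet B) :
    Integrable (fun w => ∑ i, B.indicator (fun _ => (1 : ℝ)) (w i)) (pathLaw Q μ n) ∧
    ∫ w, ∑ i, B.indicator (fun _ => (1 : ℝ)) (w i) ∂(pathLaw Q μ n) = (n + 1) * μ.real B := by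
  have hm : Measurable (B.indicator fun _ => (1 : ℝ)) := measurable_const.indicator hB
  have hint (i : Fin (n + 1)) :
      Integrable (fun w => B.indicator (fun _ => (1 : ℝ)) (w i)) (pathLaw Q μ n) :=
    .of_bound (hm.comp (measurable_pi_apply i)).aestronglyMeasurable 1
      (Eventually.of_forall fun w => by simp only [indicator]; split_ifs <;> simp)
  refine ⟨integrable_finsetSum _ fun i _ => hint i, ?_⟩
  rw [integral_finsetSum _ fun i _ => hint i]
  have h (i : Fin (n + 1)) :
      ∫ w, B.indicator (fun _ => (1 : ℝ)) (w i) ∂(pathLaw Q μ n) = μ.real B := by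
    rw [← integral_map (φ := fun w : Fin (n + 1) → X => w i) (measurable_pi_apply i).aemeasurable
      hm.aestronglyMeasurable, map_apply_pathLaw hμ, integral_indicator_const _ hB]
    simp
  simp [h]

end PathLaw


/-! ### The upper half of the variational principle -/

section VariationalInequality

/-- Gibbs' inequality for the law of the itinerary: any positive subprobability `q` on words bounds
the entropy by its mean code length `-log q`. -/
theorem blockEntropy_le_integral {X : Type*} [MeasurableSpace X] {Q : Kernel X X} [IsMarkovKernel Q]
    {μ : Measure X} [IsProbabilityMeasure μ] (𝒜 : FiniteMeasurablePartition X) (n : ℕ)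
    {q : (Fin (n + 1) → Fin 𝒜.card) → ℝ} (hq : ∀ w, 0 < q w) (hq1 : ∑ w, q w ≤ 1)
    {F : (Fin (n + 1) → X) → ℝ} (hF : Integrable F (pathLaw Q μ n))
    (h : ∀ᵐ x ∂(pathLaw Q μ n), -Real.log (q fun i => 𝒜.label (x i)) ≤ F x) :
    blockEntropy Q μ 𝒜 n ≤ ∫ x, F x ∂(pathLaw Q μ n) := by
  let W : (Fin (n + 1) → X) → Fin (n + 1) → Fin 𝒜.card := fun x i => 𝒜.label (x i)
  have hW : Measurable W :=
    measurable_pi_lambda _ fun i => 𝒜.measurable_label.comp (measurable_pi_apply i)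
  have hprob : IsProbabilityMeasure ((pathLaw Q μ n).map W) :=
    Measure.isProbabilityMeasure_map hW.aemeasurable
  have hcell (w : Fin (n + 1) → Fin 𝒜.card) :
      (μ.bind (pathKernel Q n)).real (univ.pi fun i => 𝒜.cell (w i)) =
        ((pathLaw Q μ n).map W).real {w} := by
    rw [map_measureReal_apply hW (measurableSet_singleton w), pathLaw]
    congr 1
    ext x
    simp [W, 𝒜.mem_cell_iff, funext_iff]
  have hint : Integrable (fun w => -Real.log (q w)) ((pathLaw Q μ n).map W) := .of_finite
  calc blockEntropy Q μ 𝒜 n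
      = ∑ w, Real.negMulLog (((pathLaw Q μ n).map W).real {w}) := by
        simp only [blockEntropy, hcell]
    _ ≤ ∑ w, ((pathLaw Q μ n).map W).real {w} * -Real.log (q w) :=
        sum_negMulLog_le_sum_mul_neg_log (fun _ => measureReal_nonneg) (by simp) hq hq1
    _ = ∫ w, -Real.log (q w) ∂((pathLaw Q μ n).map W) := by
        rw [integral_fintype hint]; simp only [smul_eq_mul]
    _ = ∫ x, -Real.log (q (W x)) ∂(pathLaw Q μ n) :=
        integral_map hW.aemeasurable hint.aestronglyMeasurable
    _ ≤ ∫ x, F x ∂(pathLaw Q μ n) :=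
        integral_mono_ae ((integrable_map_measure hint.aestronglyMeasurable hW.aemeasurable).1 hint)
          hF h

variable {X : Type*} [MetricSpace X] [CompactSpace X]

/-- If the exponential sums over separated sets are bounded, then there is a separated set which is
also a net. -/
theorem exists_isSeparated_net (T : Correspondence X) (φ : C(T.graph, ℝ)) (n : ℕ) {δ R : ℝ}
    (hδ : 0 < δ)
    (hR : ∀ E, T.IsSeparated n δ E → ∑ x ∈ E, Real.exp (T.birkhoff φ n x) ≤ R) :
    ∃ E, T.IsSeparated n δ E ∧ ∀ x : T.Orbit n, ∃ z ∈ E, dist x.1 z.1 < δ := by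
  classical
  -- Each term is at least `exp (-n‖φ‖)`, so separated sets have bounded cardinality; one of maximal
  -- cardinality is a net.
  have hcard (E : Finset (T.Orbit n)) (hE : T.IsSeparated n δ E) :
      (E.card : ℝ) ≤ R * Real.exp (n * ‖φ‖) := by
    have h1 (x : T.Orbit n) : Real.exp (-(n * ‖φ‖)) ≤ Real.exp (T.birkhoff φ n x) := by
      have h2 := T.birkhoff_le_add (φ := 0) (ψ := φ) (c := ‖φ‖)
        (fun p => by have := (abs_le.1 (φ.norm_coe_le_norm p)).1; simp; linarith) n x
      have h3 : T.birkhoff 0 n x = 0 := by simp [birkhoff]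
      rw [Real.exp_le_exp]
      linarith
    have h2 := (Finset.sum_le_sum fun x (_ : x ∈ E) => h1 x).trans (hR E hE)
    rw [Finset.sum_const, nsmul_eq_mul, Real.exp_neg, ← div_eq_mul_inv,
      div_le_iff₀ (Real.exp_pos _)] at h2
    exact h2
  let A : Set ℕ := {c | ∃ E, T.IsSeparated n δ E ∧ E.card = c}
  have hne : A.Nonempty := ⟨0, ∅, by simp [IsSeparated], rfl⟩
  have hbdd : BddAbove A := by
    refine ⟨⌊R * Real.exp (n * ‖φ‖)⌋₊, ?_⟩
    rintro _ ⟨E, hE, rfl⟩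
    exact Nat.le_floor (hcard E hE)
  obtain ⟨E, hE, hEc⟩ := Nat.sSup_mem hne hbdd
  refine ⟨E, hE, fun x => ?_⟩
  by_contra! hx
  have hxE : x ∉ E := fun h => by simpa using (hx x h).trans_lt' hδ
  have hins : T.IsSeparated n δ (insert x E) := by
    intro y hy z hz hyz
    rcases Finset.mem_insert.1 hy with rfl | hyE <;>
      rcases Finset.mem_insert.1 hz with rfl | hzE
    · exact absurd rfl hyz
    · exact hx z hzE
    · rw [dist_comm]; exact hx y hyE
    · exact hE y hyE z hzE hyz
  have := le_csSup hbdd ⟨_, hins, rfl⟩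
  rw [← hEc, Finset.card_insert_of_notMem hxE] at this
  omega

variable [MeasurableSpace X] [BorelSpace X] {Q : Kernel X X} [IsMarkovKernel Q]
  {μ : Measure X} [IsProbabilityMeasure μ]

theorem ae_orbit (T : Correspondence X) (hQ : T.Supports Q) (hμ : Kernel.Invariant Q μ) (n : ℕ) :
    ∀ᵐ w ∂(pathLaw Q μ n), ∀ i : Fin n, w i.succ ∈ T (w i.castSucc) := by
  refine ae_all_iff.2 fun i => ?_
  have h := T.ae_mem_graph (μ := μ) hQ
  rw [← map_pair_pathLaw hμ n i] at h
  exact ae_of_ae_map ((measurable_pi_apply _).prodMk (measurable_pi_apply _)).aemeasurable h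

theorem integrable_extend_comp (T : Correspondence X) (φ : C(T.graph, ℝ)) {n : ℕ} (i : Fin n) :
    Integrable (fun w => Function.extend (Subtype.val : T.graph → X × X) (⇑φ) 0
      (w i.castSucc, w i.succ)) (pathLaw Q μ n) :=
  .of_bound ((T.measurable_extend φ).comp
    ((measurable_pi_apply _).prodMk (measurable_pi_apply _))).aestronglyMeasurable ‖φ‖
    (Eventually.of_forall fun _ => T.norm_extend_le φ _)

theorem integral_sum_extend (T : Correspondence X) (hQ : T.Supports Q) (hμ : Kernel.Invariant Q μ)
    (φ : C(T.graph, ℝ)) (n : ℕ) :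
    ∫ w, ∑ i : Fin n, Function.extend (Subtype.val : T.graph → X × X) (⇑φ) 0
      (w i.castSucc, w i.succ) ∂(pathLaw Q μ n) = n * T.doubleIntegral Q μ φ := by
  rw [integral_finsetSum _ fun i _ => T.integrable_extend_comp φ i]
  have h (i : Fin n) : ∫ w, Function.extend (Subtype.val : T.graph → X × X) (⇑φ) 0
      (w i.castSucc, w i.succ) ∂(pathLaw Q μ n) = T.doubleIntegral Q μ φ := by
    rw [T.doubleIntegral_eq_integral_compProd hQ, ← map_pair_pathLaw hμ n i, integral_map
      ((measurable_pi_apply _).prodMk (measurable_pi_apply _)).aemeasurable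
      (T.measurable_extend φ).aestronglyMeasurable]
  simp [h]

/-- The finite-time estimate behind the variational inequality. -/
theorem eventually_blockEntropy_le [Nonempty X] (T : Correspondence X) (hQ : T.Supports Q)
    (hμ : Kernel.Invariant Q μ) {φ : C(T.graph, ℝ)} {a ε : ℝ} (ha : T.pressure φ < a) (hε : 0 < ε)
    (𝒜 : FiniteMeasurablePartition X) :
    ∀ᶠ n : ℕ in atTop, blockEntropy Q μ 𝒜 n ≤
      n * (a - T.doubleIntegral Q μ φ) + (n + 1) * (3 * ε) := by
  -- The cost of one wrongly guessed letter. The bad set will have measure at most `ε / (M + 1)`, so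
  -- the mean cost of errors is at most `ε` per letter.
  set M : ℝ := |Real.log ((1 - Real.exp (-ε)) / 𝒜.card)| with hM
  have hM0 : 0 ≤ M := abs_nonneg _
  obtain ⟨G, hG, hGμ, δ₁, hδ₁, g, hg⟩ := 𝒜.exists_guess μ (κ := ε / (M + 1)) (by positivity)
  obtain ⟨δ₂, hδ₂, huc⟩ := Metric.uniformContinuous_iff.1
    (CompactSpace.uniformContinuous_of_continuous φ.continuous) ε hε
  set δ := min δ₁ δ₂ with hδ
  have hδ0 : 0 < δ := lt_min hδ₁ hδ₂
  filter_upwards [T.eventually_sum_le_of_pressure_lt ha hδ0] with n hn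
  obtain ⟨E, hE, hnet⟩ := T.exists_isSeparated_net φ n hδ0 hn
  have hEne : E.Nonempty := by
    obtain ⟨z, hz, -⟩ := hnet (Classical.arbitrary _)
    exact ⟨z, hz⟩
  obtain ⟨q, hq, hq1, hqlog⟩ := exists_weight_on_words E hEne (T.birkhoff φ n) (n + 1) 𝒜.card
    (fun z i => g (z.1 i)) hε
  have hZ : Real.log (∑ z ∈ E, Real.exp (T.birkhoff φ n z)) ≤ n * a := by
    rw [Real.log_le_iff_le_exp (Finset.sum_pos (fun _ _ => Real.exp_pos _) hEne)]
    exact hn E hE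
  obtain ⟨hind, hindv⟩ := integral_sum_indicator (Q := Q) hμ n hG.compl
  have hext : Integrable (fun w => ∑ i : Fin n, Function.extend (Subtype.val : T.graph → X × X)
      (⇑φ) 0 (w i.castSucc, w i.succ)) (pathLaw Q μ n) :=
    integrable_finsetSum _ fun i _ => T.integrable_extend_comp φ i
  have hc : Integrable (fun _ => n * a + n * ε + (n + 1) * ε) (pathLaw Q μ n) :=
    integrable_const _
  -- An orbit has `n + 1` letters but `n` transitions. The three errors are `n * ε` from uniform
  -- continuity of `φ`, `(n + 1) * ε` for kept letters and at most `(n + 1) * ε` for wrong ones.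
  refine (blockEntropy_le_integral 𝒜 n hq hq1 ((hc.sub hext).add (hind.const_mul M)) ?_).trans ?_
  · filter_upwards [T.ae_orbit hQ hμ n] with x hx
    obtain ⟨z, hz, hxz⟩ := hnet ⟨x, hx⟩
    have hxz' (i : Fin (n + 1)) : dist (x i) (z.1 i) < δ := (dist_le_pi_dist _ _ i).trans_lt hxz
    have h1 := hqlog z hz fun i => 𝒜.label (x i)
    have h2 : ∑ i : Fin n, Function.extend (Subtype.val : T.graph → X × X) (⇑φ) 0
        (x i.castSucc, x i.succ) ≤ T.birkhoff φ n z + n * ε := by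
      have : T.birkhoff φ n z + n * ε = ∑ i : Fin n,
          (φ ⟨(z.1 i.castSucc, z.1 i.succ), z.2 i⟩ + ε) := by
        simp [birkhoff, Finset.sum_add_distrib]
      rw [this]
      refine Finset.sum_le_sum fun i _ => ?_
      rw [T.extend_apply_of_mem φ ⟨(x i.castSucc, x i.succ), hx i⟩]
      have hd : dist (⟨(x i.castSucc, x i.succ), hx i⟩ : T.graph)
          ⟨(z.1 i.castSucc, z.1 i.succ), z.2 i⟩ < δ₂ :=
        max_lt ((hxz' _).trans_le (min_le_right _ _)) ((hxz' _).trans_le (min_le_right _ _))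
      have := (abs_lt.1 (huc hd)).2
      linarith
    have h3 : ∑ i, (if 𝒜.label (x i) = g (z.1 i) then (0 : ℝ) else 1) ≤
        ∑ i, Gᶜ.indicator (fun _ => (1 : ℝ)) (x i) := by
      refine Finset.sum_le_sum fun i _ => ?_
      by_cases hi : x i ∈ G
      · simp [hi, hg _ hi _ ((hxz' i).trans_le (min_le_left _ _))]
      · simp only [indicator_of_mem (mem_compl hi)]
        split_ifs <;> simp
    have h4 := mul_le_mul_of_nonneg_left h3 hM0
    simp only [Pi.add_apply, Pi.sub_apply]
    push_cast at h1
    linarith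
  · have h1 : M * μ.real Gᶜ ≤ ε := by
      have : M * μ.real Gᶜ ≤ M * (ε / (M + 1)) := mul_le_mul_of_nonneg_left hGμ hM0
      refine this.trans ?_
      rw [mul_div_assoc', div_le_iff₀ (by positivity)]
      nlinarith
    rw [integral_add' (hc.sub hext) (hind.const_mul M), integral_sub' hc hext, integral_const_mul,
      hindv, T.integral_sum_extend hQ hμ]
    simp only [integral_const, probReal_univ, one_smul]
    have h2 : (n + 1 : ℝ) * (M * μ.real Gᶜ) ≤ (n + 1) * ε :=
      mul_le_mul_of_nonneg_left h1 (by positivity)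
    nlinarith

/-- The inequality `h_μ(Q) + ∫∫ φ dQ dμ ≤ P(T, φ)` of the **variational principle**. -/
theorem kernelEntropy_le_sub [Nonempty X] (T : Correspondence X) (hT : T.topEntropy < ⊤)
    (hQ : T.Supports Q) (hμ : Kernel.Invariant Q μ) (φ : C(T.graph, ℝ)) :
    kernelEntropy Q μ ≤ ((T.realPressure φ - T.doubleIntegral Q μ φ : ℝ) : EReal) := by
  refine iSup_le fun 𝒜 => ?_
  set c := T.realPressure φ - T.doubleIntegral Q μ φ with hc
  refine EReal.le_of_forall_lt_iff_le.1 fun b hb => ?_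
  have hcb : c < b := by exact_mod_cast hb
  -- Three `ε` come from the block estimate, one from the bound on the pressure, and one absorbs
  -- `|c|` when `n * c` is compared with `(n + 1) * c`.
  obtain ⟨ε, hε, hεb⟩ : ∃ ε > 0, c + 5 * ε ≤ b := ⟨(b - c) / 5, by linarith, by linarith⟩
  have ha : T.pressure φ < ((T.realPressure φ + ε : ℝ) : EReal) := by
    rw [← T.coe_realPressure hT]; exact_mod_cast lt_add_of_pos_right _ hε
  obtain ⟨N, hN⟩ := exists_nat_gt (|c| / ε)
  refine limsup_le_of_le (h := ?_)
  filter_upwards [T.eventually_blockEntropy_le hQ hμ ha hε 𝒜, eventually_ge_atTop N] with n hn hnN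
  rw [EReal.coe_le_coe_iff, div_le_iff₀ (by positivity)]
  have h1 : |c| ≤ n * ε := by
    rw [← div_le_iff₀ hε]
    exact hN.le.trans (by exact_mod_cast hnN)
  have h2 := neg_abs_le c
  have h3 : (c + 5 * ε) * (n + 1) ≤ b * (n + 1) :=
    mul_le_mul_of_nonneg_right hεb (by positivity)
  have h4 : n * (T.realPressure φ + ε - T.doubleIntegral Q μ φ) = n * c + n * ε := by
    rw [hc]; ring
  rw [h4] at hn
  linarith

end VariationalInequality

/-- The argument for type II states applies with `kernelEntropy_le_sub` in place of
`abstractEntropy_le`: the entropy does not depend on the potential and is bounded through every `ψ`.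
-/
theorem IsEquilibriumI.subgradient {X : Type*} [MetricSpace X] [CompactSpace X] [Nonempty X]
    [MeasurableSpace X] [BorelSpace X] {T : Correspondence X} (hT : T.topEntropy < ⊤)
    {φ : C(T.graph, ℝ)} {Q : Kernel X X} {μ : Measure X} (h : T.IsEquilibriumI φ Q μ)
    (ψ : C(T.graph, ℝ)) :
    T.realPressure φ + (T.doubleIntegral Q μ ψ - T.doubleIntegral Q μ φ) ≤
      T.realPressure ψ := by
  have := h.markov
  have := h.prob
  have h1 : (T.realPressure φ : EReal) ≤
      ((T.realPressure ψ - T.doubleIntegral Q μ ψ : ℝ) : EReal) + T.doubleIntegral Q μ φ := by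
    rw [T.coe_realPressure hT, h.pressure_eq]
    exact add_le_add_left (T.kernelEntropy_le_sub hT h.supports h.invariant ψ) _
  have h2 : T.realPressure φ ≤
      T.realPressure ψ - T.doubleIntegral Q μ ψ + T.doubleIntegral Q μ φ := by exact_mod_cast h1
  linarith

end Correspondence

theorem mainTheorem10 {X : Type*} [MetricSpace X] [CompactSpace X] [Nonempty X]
    [MeasurableSpace X] [BorelSpace X] (T : Correspondence X) (hT : T.topEntropy < ⊤) :
    ∃ D : Set C(T.graph, ℝ), Dense D ∧ ∀ φ ∈ D,
      (∃ (Q : Kernel X X) (μ : Measure X), T.IsEquilibriumII φ Q μ) ∧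
      (∀ (Q Q' : Kernel X X) (μ μ' : Measure X),
        T.IsEquilibriumII φ Q μ → T.IsEquilibriumII φ Q' μ' →
          μ = μ' ∧ ∀ᵐ x ∂μ, ∀ A : Set X, MeasurableSet A → Q x A = Q' x A) ∧
      (∀ (Q Q' : Kernel X X) (μ μ' : Measure X),
        T.IsEquilibriumI φ Q μ → T.IsEquilibriumI φ Q' μ' →
          μ = μ' ∧ ∀ᵐ x ∂μ, ∀ A : Set X, MeasurableSet A → Q x A = Q' x A) := by
  refine ⟨_, (T.lipschitzWith_realPressure hT).dense_subsingleton_subgradient, fun φ hφ =>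
    ⟨T.exists_isEquilibriumII hT φ, fun Q Q' μ μ' h h' => ?_, fun Q Q' μ μ' h h' => ?_⟩⟩
  · exact T.eq_of_subgradient hφ h.markov h'.markov h.prob h'.prob h.supports h'.supports
      (h.subgradient hT) (h'.subgradient hT)
  · exact T.eq_of_subgradient hφ h.markov h'.markov h.prob h'.prob h.supports h'.supports
      (h.subgradient hT) (h'.subgradient hT)
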